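/- For modules $M,N$ over a commutative Noetherian ring $R$ put $p^R(M,N)=\sup\{i\in\mathbb N : \operatorname{Ext}^i_R(M,N)\neq 0\}\in\mathbb N\cup\{\infty\}$ (with $\sup\emptyset=0$), and let $\xi(R)$ be the supremum of all finite values $p^R(M,N)$, where $M$ runs over the finitely generated $R$-modules and $N$ over all $R$-modules. Let $R$ be a commutative Noetherian local ring of Krull dimension $d$. (1) Suppose that $R$ is Gorenstein (that is, $R$ has finite injective dimension as an $R$-module) and $\xi(R)<\infty$. Let $M$ be a finitely generated $R$-module and $N$ an arbitrary $R$-module. If $\operatorname{Ext}^i_R(M,N)=0$ for all $i\gg 0$, then $\operatorname{Ext}^i_R(N,M)=0$ for all $i>d$. (2) Suppose that $R$ is a complete intersection, that is, the completion of $R$ at its maximal ideal is isomorphic to the quotient of a regular local ring by an ideal generated by a regular sequence. Let $M$ be a finitely generated $R$-module and $N$ an arbitrary $R$-module. If $\operatorname{Ext}^i_R(M,N)=0$ for all $i\gg 0$, then $\operatorname{Ext}^i_R(N,M)=0$ for all $i>d$. -/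

import Mathlib

open CategoryTheory CategoryTheory.Abelian IsLocalRing

universe u

/-- `p^R(M, N) = sup {i ∈ ℕ | Ext^i_R(M, N) ≠ 0}`, with values in `ℕ ∪ {∞}`
(the supremum of the empty set is `0`). -/
noncomputable def extSup {R : Type u} [CommRing R] (M N : ModuleCat.{u} R) : ℕ∞ :=
  ⨆ (i : ℕ) (_ : Nontrivial (Ext M N i)), (i : ℕ∞)

/-- `ξ(R)`: the supremum of the finite values of `p^R(M, N)`, where `M` is a finitely
generated `R`-module and `N` is an arbitrary `R`-module. -/
noncomputable def xi (R : Type u) [CommRing R] : ℕ∞ :=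
  ⨆ (M : ModuleCat.{u} R) (N : ModuleCat.{u} R) (_ : Module.Finite R M) (_ : extSup M N < ⊤),
    extSup M N

/-- A Gorenstein local ring: a Noetherian local ring which has finite injective dimension
as a module over itself. -/
class IsGorensteinLocalRing (R : Type u) [CommRing R] : Prop extends
    IsLocalRing R, IsNoetherianRing R where
  injectiveDimension_ne_top : injectiveDimension (ModuleCat.of R R) ≠ ⊤

/-- A complete intersection local ring: a Noetherian local ring whose completion at the maximal
ideal is isomorphic to the quotient of a regular local ring by an ideal generated by a regular
sequence. -/
class IsCompleteIntersectionLocalRing (R : Type u) [CommRing R] : Prop extends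
    IsLocalRing R, IsNoetherianRing R where
  exists_presentation : ∃ (S : Type u) (_ : CommRing S) (_ : IsRegularLocalRing S) (rs : List S),
    RingTheory.Sequence.IsRegular S rs ∧
      Nonempty ((S ⧸ Ideal.ofList rs) ≃+* AdicCompletion (maximalIdeal R) R)

/-!
Let `R` be a Noetherian local ring of finite self-injective dimension; by
`ExtVanishes.of_gt_ringKrullDim` that dimension is at most `d = dim R`. Both parts follow from one
duality argument, `ExtVanishes.symm_of_bounded`, whose only further input is a uniform bound: there
is `n` such that `Ext^i(M, N) = 0` for all `i ≫ 0`, with `M` finite, implies `Ext^i(M, N) = 0` for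
all `i > n`. In part (1) this is the finiteness of `ξ(R)`.

The duality argument. Passing to syzygies of `M`, one may assume `Ext^i(M, R) = 0` for all `i > 0`.
Such modules (`ExtOrthogonal`) are reflexive, duality is exact on them, and they have cosyzygies of
the same kind, obtained by dualizing a presentation of the dual; so the uniform bound, applied to
far cosyzygies, forces `Ext^i(M, N) = 0` for *all* `i > 0`. Write `M = X*` with `X = M*`. For a
syzygy `Y` of `X` in a free module `F`, the vanishing makes the evaluation map `Y ⊗ N → Hom(Y*, N)`
bijective, and `Y ⊗ N → F ⊗ N` becomes the injection `Hom(Y*, N) → Hom(F*, N)`. In other words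
`Tor_i(X, N) = 0` for `i > 0`, which for an injective module `E` gives `Ext^i(N, Hom(X, E)) = 0`
for `i > 0`. Applying `Hom(X, -)` to an injective resolution of `R` of length `d` yields
`Ext^i(N, X*) = 0` for `i > d`, and `X* = M`.

For a complete intersection, the uniform bound and finite self-injective dimension (together
`HasExtBound`) hold for regular local rings, which have finite global dimension. They pass from `A`
to `A ⧸ (x)` for a regular element `x` (`HasExtBound.quotient`): for `A ⧸ (x)`-modules with
`Ext_A^i(M, N) = 0` for `i > n`, the modules `Ext^i(M, N)` over `A ⧸ (x)` are periodic of period two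
above `n`, so they vanish there if they vanish eventually; the self-injective dimension is
controlled by Rees' isomorphism. Finally both properties descend from the completion to `R` by
faithful flatness (`HasExtBound.of_faithfullyFlat`).
-/

/-! ### Vanishing of `Ext` along short exact sequences of linear maps -/

section ExtVanishes

variable (R : Type u) [CommRing R]

/-- `Ext^i_R(M, N) = 0`, for unbundled `R`-modules `M` and `N`. -/
def ExtVanishes (M N : Type u) [AddCommGroup M] [Module R M] [AddCommGroup N] [Module R N]
    (i : ℕ) : Prop :=
  Subsingleton (Ext (ModuleCat.of R M) (ModuleCat.of R N) i)

variable {R}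
variable {A B C N : Type u} [AddCommGroup A] [Module R A] [AddCommGroup B] [Module R B]
  [AddCommGroup C] [Module R C] [AddCommGroup N] [Module R N]

theorem extVanishes_iff {M : Type u} [AddCommGroup M] [Module R M] {i : ℕ} :
    ExtVanishes R M N i ↔ ∀ e : Ext (ModuleCat.of R M) (ModuleCat.of R N) i, e = 0 :=
  ⟨fun h _ ↦ h.elim _ _, fun h ↦ ⟨fun a b ↦ (h a).trans (h b).symm⟩⟩

/-- The short complex in `ModuleCat R` attached to an exact pair of linear maps. -/
abbrev Function.Exact.moduleCatShortComplex {f : A →ₗ[R] B} {g : B →ₗ[R] C}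
    (h : Function.Exact f g) : ShortComplex (ModuleCat.{u} R) :=
  ModuleCat.shortComplexOfCompEqZero f g h.linearMap_comp_eq_zero

theorem Function.Exact.moduleCatShortExact {f : A →ₗ[R] B} {g : B →ₗ[R] C}
    (h : Function.Exact f g) (hf : Function.Injective f) (hg : Function.Surjective g) :
    h.moduleCatShortComplex.ShortExact :=
  ModuleCat.shortComplex_shortExact _ h hf hg

namespace ExtVanishes

section Sequences

variable {f : A →ₗ[R] B} {g : B →ₗ[R] C} {i : ℕ}

theorem middle_left (hf : Function.Injective f) (h : Function.Exact f g)
    (hg : Function.Surjective g) (hA : ExtVanishes R A N i) (hC : ExtVanishes R C N i) :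
    ExtVanishes R B N i := by
  rw [extVanishes_iff] at *
  intro e
  obtain ⟨x, rfl⟩ := Ext.contravariant_sequence_exact₂ (h.moduleCatShortExact hf hg) _ e (hA _)
  rw [hC x, Ext.comp_zero]

theorem sub_left (hf : Function.Injective f) (h : Function.Exact f g)
    (hg : Function.Surjective g) (hB : ExtVanishes R B N i) (hC : ExtVanishes R C N (i + 1)) :
    ExtVanishes R A N i := by
  rw [extVanishes_iff] at *
  intro e
  obtain ⟨x, rfl⟩ := Ext.contravariant_sequence_exact₁ (h.moduleCatShortExact hf hg) _ e
    (add_comm 1 i) (hC _)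
  rw [hB x, Ext.comp_zero]

theorem quotient_left (hf : Function.Injective f) (h : Function.Exact f g)
    (hg : Function.Surjective g) (hA : ExtVanishes R A N i) (hB : ExtVanishes R B N (i + 1)) :
    ExtVanishes R C N (i + 1) := by
  rw [extVanishes_iff] at *
  intro e
  obtain ⟨x, rfl⟩ := Ext.contravariant_sequence_exact₃ (h.moduleCatShortExact hf hg) _ e (hB _)
    (add_comm 1 i)
  rw [hA x, Ext.comp_zero]

theorem middle_right (hf : Function.Injective f) (h : Function.Exact f g)
    (hg : Function.Surjective g) (hA : ExtVanishes R N A i) (hC : ExtVanishes R N C i) :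
    ExtVanishes R N B i := by
  rw [extVanishes_iff] at *
  intro e
  obtain ⟨x, rfl⟩ := Ext.covariant_sequence_exact₂ _ (h.moduleCatShortExact hf hg) e (hC _)
  rw [hA x, Ext.zero_comp]

theorem quotient_right (hf : Function.Injective f) (h : Function.Exact f g)
    (hg : Function.Surjective g) (hB : ExtVanishes R N B i) (hA : ExtVanishes R N A (i + 1)) :
    ExtVanishes R N C i := by
  rw [extVanishes_iff] at *
  intro e
  obtain ⟨x, rfl⟩ := Ext.covariant_sequence_exact₃ _ (h.moduleCatShortExact hf hg) e rfl (hA _)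
  rw [hB x, Ext.zero_comp]

theorem sub_right (hf : Function.Injective f) (h : Function.Exact f g)
    (hg : Function.Surjective g) (hC : ExtVanishes R N C i) (hB : ExtVanishes R N B (i + 1)) :
    ExtVanishes R N A (i + 1) := by
  rw [extVanishes_iff] at *
  intro e
  obtain ⟨x, rfl⟩ := Ext.covariant_sequence_exact₁ _ (h.moduleCatShortExact hf hg) e (hB _) rfl
  rw [hC x, Ext.zero_comp]

end Sequences

variable (R N) in
theorem of_projective (P : Type u) [AddCommGroup P] [Module R P] [Module.Projective R P] (i : ℕ) :
    ExtVanishes R P N (i + 1) :=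
  have : Projective (ModuleCat.of R P) := ModuleCat.projective_of_categoryTheory_projective _
  Ext.subsingleton_of_projective _ _ i

variable (R N) in
theorem of_injective (E : Type u) [AddCommGroup E] [Module R E] [Module.Injective R E] (i : ℕ) :
    ExtVanishes R N E (i + 1) :=
  have : Injective (ModuleCat.of R E) := Module.injective_object_of_injective_module R E
  Ext.subsingleton_of_injective _ _ i

theorem congr_left (e : A ≃ₗ[R] B) {i : ℕ} (h : ExtVanishes R A N i) : ExtVanishes R B N i := by
  rw [extVanishes_iff] at *
  intro x
  have hx : (Ext.mk₀ e.toModuleIso.inv).comp ((Ext.mk₀ e.toModuleIso.hom).comp x (zero_add i))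
      (zero_add i) = x := by
    rw [Ext.mk₀_comp_mk₀_assoc, Iso.inv_hom_id, Ext.mk₀_id_comp]
  rw [← hx, h ((Ext.mk₀ e.toModuleIso.hom).comp x (zero_add i)), Ext.comp_zero]

theorem congr_right (e : A ≃ₗ[R] B) {i : ℕ} (h : ExtVanishes R N A i) : ExtVanishes R N B i := by
  rw [extVanishes_iff] at *
  intro x
  have hx : (x.comp (Ext.mk₀ e.toModuleIso.inv) (add_zero i)).comp (Ext.mk₀ e.toModuleIso.hom)
      (add_zero i) = x := by
    rw [Ext.comp_assoc_of_second_deg_zero, Ext.mk₀_comp_mk₀, Iso.inv_hom_id, Ext.comp_mk₀_id]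
  rw [← hx, h (x.comp (Ext.mk₀ e.toModuleIso.inv) (add_zero i)), Ext.zero_comp]

theorem pi_right (M : Type u) [AddCommGroup M] [Module R M] {i : ℕ} (h : ExtVanishes R N M i)
    (n : ℕ) : ExtVanishes R N (Fin n → M) i := by
  induction n with
  | zero =>
    rw [extVanishes_iff]
    intro e
    have : Limits.IsZero (ModuleCat.of R (Fin 0 → M)) :=
      (ModuleCat.isZero_iff_subsingleton).2 (inferInstanceAs (Subsingleton (Fin 0 → M)))
    rw [← e.comp_mk₀_id, this.eq_zero_of_tgt (𝟙 _), Ext.mk₀_zero, Ext.comp_zero]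
  | succ n ih =>
    refine congr_right (Fin.consLinearEquiv R fun _ ↦ M) ?_
    exact middle_right LinearMap.inl_injective (Function.Exact.inl_snd (R := R))
      LinearMap.snd_surjective h ih

section One

variable {f : A →ₗ[R] B} {g : B →ₗ[R] C}

/-- If every map `A → N` extends to `B`, then `Ext¹(C, N)` embeds into `Ext¹(B, N)`. -/
theorem one_of_extends (hf : Function.Injective f) (h : Function.Exact f g)
    (hg : Function.Surjective g) (hB : ExtVanishes R B N 1)
    (hext : ∀ φ : A →ₗ[R] N, ∃ ψ : B →ₗ[R] N, ψ ∘ₗ f = φ) : ExtVanishes R C N 1 := by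
  rw [extVanishes_iff] at *
  intro e
  have hS := h.moduleCatShortExact hf hg
  obtain ⟨x, rfl⟩ := Ext.contravariant_sequence_exact₃ hS _ e (hB _) (add_comm 1 0)
  obtain ⟨φ, rfl⟩ := (Ext.mk₀_bijective _ _).2 x
  obtain ⟨ψ, hψ⟩ := hext φ.hom
  have : φ = ModuleCat.ofHom f ≫ ModuleCat.ofHom ψ := by
    ext1; exact hψ.symm
  rw [this, ← Ext.mk₀_comp_mk₀]
  exact hS.extClass_comp_assoc _

theorem extends_of_one (hf : Function.Injective f) (h : Function.Exact f g)
    (hg : Function.Surjective g) (hC : ExtVanishes R C N 1) (φ : A →ₗ[R] N) :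
    ∃ ψ : B →ₗ[R] N, ψ ∘ₗ f = φ := by
  rw [extVanishes_iff] at hC
  have hS := h.moduleCatShortExact hf hg
  obtain ⟨x, hx⟩ := Ext.contravariant_sequence_exact₁ hS _ (Ext.mk₀ (ModuleCat.ofHom φ))
    (add_comm 1 0) (hC _)
  obtain ⟨ψ, rfl⟩ := (Ext.mk₀_bijective _ _).2 x
  rw [Ext.mk₀_comp_mk₀, (Ext.mk₀_bijective _ _).1.eq_iff] at hx
  exact ⟨ψ.hom, congrArg ModuleCat.Hom.hom hx⟩

/-- If every map `N → C` lifts to `B`, then `Ext¹(N, A)` embeds into `Ext¹(N, B)`. -/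
theorem one_of_lifts (hf : Function.Injective f) (h : Function.Exact f g)
    (hg : Function.Surjective g) (hB : ExtVanishes R N B 1)
    (hlift : ∀ φ : N →ₗ[R] C, ∃ ψ : N →ₗ[R] B, g ∘ₗ ψ = φ) : ExtVanishes R N A 1 := by
  rw [extVanishes_iff] at *
  intro e
  have hS := h.moduleCatShortExact hf hg
  obtain ⟨x, rfl⟩ := Ext.covariant_sequence_exact₁ _ hS e (hB _) (zero_add 1)
  obtain ⟨φ, rfl⟩ := (Ext.mk₀_bijective _ _).2 x
  obtain ⟨ψ, hψ⟩ := hlift φ.hom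
  have : φ = ModuleCat.ofHom ψ ≫ ModuleCat.ofHom g := by
    ext1; exact hψ.symm
  rw [this, ← Ext.mk₀_comp_mk₀, Ext.comp_assoc_of_second_deg_zero]
  rw [show (Ext.mk₀ (ModuleCat.ofHom g)).comp hS.extClass (zero_add 1) = 0 from
    hS.comp_extClass, Ext.comp_zero]

theorem lifts_of_one (hf : Function.Injective f) (h : Function.Exact f g)
    (hg : Function.Surjective g) (hA : ExtVanishes R N A 1) (φ : N →ₗ[R] C) :
    ∃ ψ : N →ₗ[R] B, g ∘ₗ ψ = φ := by
  rw [extVanishes_iff] at hA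
  have hS := h.moduleCatShortExact hf hg
  obtain ⟨x, hx⟩ := Ext.covariant_sequence_exact₃ _ hS (Ext.mk₀ (ModuleCat.ofHom φ))
    (zero_add 1) (hA _)
  obtain ⟨ψ, rfl⟩ := (Ext.mk₀_bijective _ _).2 x
  rw [Ext.mk₀_comp_mk₀, (Ext.mk₀_bijective _ _).1.eq_iff] at hx
  exact ⟨ψ.hom, congrArg ModuleCat.Hom.hom hx⟩

variable [Module.Projective R B]

theorem one_iff (hf : Function.Injective f) (h : Function.Exact f g)
    (hg : Function.Surjective g) :
    ExtVanishes R C N 1 ↔ ∀ φ : A →ₗ[R] N, ∃ ψ : B →ₗ[R] N, ψ ∘ₗ f = φ :=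
  ⟨extends_of_one hf h hg, one_of_extends hf h hg (of_projective R N B 0)⟩

/-- Dimension shifting along a projective middle term. -/
theorem succ_iff (hf : Function.Injective f) (h : Function.Exact f g)
    (hg : Function.Surjective g) (i : ℕ) :
    ExtVanishes R C N (i + 2) ↔ ExtVanishes R A N (i + 1) :=
  ⟨sub_left hf h hg (of_projective R N B i),
    fun hA ↦ quotient_left hf h hg hA (of_projective R N B (i + 1))⟩

end One

end ExtVanishes

/-- A finite module over a Noetherian ring is the quotient of some `R ^ n` by a finite module. -/
theorem Module.Finite.exists_presentation (M : Type u) [AddCommGroup M] [Module R M]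
    [IsNoetherianRing R] [Module.Finite R M] :
    ∃ (n : ℕ) (g : (Fin n → R) →ₗ[R] M), Function.Surjective g ∧
      Module.Finite R (LinearMap.ker g) := by
  obtain ⟨n, g, hg⟩ := Module.Finite.exists_fin' R M
  exact ⟨n, g, hg, inferInstance⟩

end ExtVanishes

/-! ### Testing injective dimension on cyclic modules and on the residue field -/

section InjectiveDimension

variable {R : Type u} [CommRing R] {N : Type u} [AddCommGroup N] [Module R N]

theorem Module.exists_injective_embedding (N : Type u) [AddCommGroup N] [Module R N] :
    ∃ (E : Type u) (_ : AddCommGroup E) (_ : Module R E) (f : N →ₗ[R] E),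
      Module.Injective R E ∧ Function.Injective f := by
  let ⟨I, _, f, _⟩ := EnoughInjectives.presentation (ModuleCat.of R N)
  exact ⟨I, _, _, f.hom, Module.injective_module_of_injective_object R I,
    (ModuleCat.mono_iff_injective f).mp ‹_›⟩

namespace ExtVanishes

theorem injective_of_quotient_ideal (h : ∀ I : Ideal R, ExtVanishes R (R ⧸ I) N 1) :
    Module.Injective R N := by
  refine Module.Baer.injective fun I g ↦ ?_
  obtain ⟨ψ, hψ⟩ := extends_of_one I.subtype_injective (LinearMap.exact_subtype_mkQ I)
    I.mkQ_surjective (h I) g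
  exact ⟨ψ, fun x hx ↦ LinearMap.congr_fun hψ ⟨x, hx⟩⟩

/-- Baer's criterion in arbitrary degree: the injective dimension of `N` is detected on cyclic
modules. -/
theorem of_forall_quotient_ideal {n : ℕ}
    (h : ∀ (I : Ideal R), ∀ i > n, ExtVanishes R (R ⧸ I) N i)
    (M : Type u) [AddCommGroup M] [Module R M] : ∀ i > n, ExtVanishes R M N i := by
  induction n generalizing N with
  | zero =>
    have := injective_of_quotient_ideal fun I ↦ h I 1 one_pos
    intro i hi
    obtain ⟨i, rfl⟩ := Nat.exists_eq_add_of_lt hi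
    exact of_injective R M N _
  | succ n ih =>
    obtain ⟨E, _, _, f, hE, hf⟩ := Module.exists_injective_embedding (R := R) N
    have hex : Function.Exact f (LinearMap.range f).mkQ := f.exact_map_mkQ_range
    have hg := (LinearMap.range f).mkQ_surjective
    have key := ih (N := E ⧸ LinearMap.range f) fun I i hi ↦ by
      obtain ⟨j, rfl⟩ : ∃ j, i = j + 1 := ⟨i - 1, by omega⟩
      exact quotient_right hf hex hg (of_injective R _ E j) (h I _ (by omega))
    intro i hi
    obtain ⟨j, rfl⟩ : ∃ j, i = j + 1 := ⟨i - 1, by omega⟩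
    exact sub_right hf hex hg (key j (by omega)) (of_injective R _ E j)

/-- For a finite module `N` over a Noetherian local ring, vanishing of `Ext^i(k, N)` for all
`i > n`, where `k` is the residue field, propagates to all cyclic modules.
This is a Noetherian induction on `I`: for `a ∉ I` there is an exact sequence
`0 → R ⧸ (I : a) → R ⧸ I → R ⧸ (I + a) → 0`. Either some `I : a` is strictly larger than `I`, or
multiplication by any `a ∈ 𝔪 \ I` is injective on `R ⧸ I`; then it is surjective on
`Ext^i(R ⧸ I, N)`, which vanishes by Nakayama. -/
theorem quotient_ideal_of_residueField [IsLocalRing R] [IsNoetherianRing R] [Module.Finite R N]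
    {n : ℕ} (h : ∀ i > n, ExtVanishes R (R ⧸ maximalIdeal R) N i) (I : Ideal R) :
    ∀ i > n, ExtVanishes R (R ⧸ I) N i := by
  induction I using WellFoundedGT.induction with
  | ind I ih =>
  intro i hi
  by_cases hI : I = ⊤
  · obtain ⟨j, rfl⟩ : ∃ j, i = j + 1 := ⟨i - 1, by omega⟩
    have : Subsingleton (R ⧸ I) := Ideal.Quotient.subsingleton_iff.2 hI
    exact of_projective R N _ j
  have sup_lt (a : R) (ha : a ∉ I) : I < I ⊔ Ideal.span {a} :=
    lt_of_le_of_ne le_sup_left fun he ↦ ha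
      (he ▸ (le_sup_right : _ ≤ I ⊔ _) (Ideal.mem_span_singleton_self a))
  let colon (a : R) : Ideal R := Submodule.comap (LinearMap.lsmul R R a) I
  have le_colon (a : R) : I ≤ colon a := fun x hx ↦ I.mul_mem_left a hx
  let f (a : R) : (R ⧸ colon a) →ₗ[R] R ⧸ I := Submodule.mapQ _ _ (LinearMap.lsmul R R a) le_rfl
  let g (a : R) : (R ⧸ I) →ₗ[R] R ⧸ (I ⊔ Ideal.span {a}) := Submodule.factor le_sup_left
  have hf (a : R) : Function.Injective (f a) := by
    refine (injective_iff_map_eq_zero _).2 fun x hx ↦ ?_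
    obtain ⟨x, rfl⟩ := Submodule.mkQ_surjective _ x
    exact (Submodule.Quotient.mk_eq_zero _).2 ((Submodule.Quotient.mk_eq_zero I).1 hx)
  have hg (a : R) : Function.Surjective (g a) := Submodule.factor_surjective _
  have hfg (a : R) : Function.Exact (f a) (g a) := by
    intro y
    obtain ⟨y, rfl⟩ := Submodule.mkQ_surjective _ y
    constructor
    · intro hy
      have hy : y ∈ I ⊔ Ideal.span {a} := (Submodule.Quotient.mk_eq_zero _).1 hy
      obtain ⟨b, hb, c, hc, rfl⟩ := Submodule.mem_sup.1 hy
      obtain ⟨c, rfl⟩ := Ideal.mem_span_singleton'.1 hc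
      refine ⟨Submodule.Quotient.mk c, ?_⟩
      refine (Submodule.Quotient.eq _).2 ?_
      simpa [mul_comm a c] using hb
    · rintro ⟨x, hx⟩
      obtain ⟨x, rfl⟩ := Submodule.mkQ_surjective _ x
      have hx : a * x - y ∈ I := (Submodule.Quotient.eq _).1 hx
      refine (Submodule.Quotient.mk_eq_zero _).2 ?_
      rw [← sub_sub_cancel (a * x) y]
      exact sub_mem (Ideal.mul_mem_right _ _
        ((le_sup_right : _ ≤ I ⊔ _) (Ideal.mem_span_singleton_self a)))
        ((le_sup_left : I ≤ _) hx)
  by_cases hc : ∃ a ∉ I, I < colon a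
  · obtain ⟨a, ha, hlt⟩ := hc
    exact middle_left (hf a) (hfg a) (hg a) (ih _ hlt i hi) (ih _ (sup_lt a ha) i hi)
  push Not at hc
  have colon_eq (a : R) (ha : a ∉ I) : colon a = I :=
    ((le_colon a).eq_or_lt.resolve_right (hc a ha)).symm
  rcases (le_maximalIdeal hI).eq_or_lt with rfl | hlt
  · exact h i hi
  obtain ⟨a, ham, ha⟩ := SetLike.exists_of_lt hlt
  let f' : (R ⧸ I) →ₗ[R] R ⧸ I := LinearMap.lsmul R _ a
  have hff' (x : R ⧸ I) : f' x = f a (Submodule.quotEquivOfEq _ _ (colon_eq a ha).symm x) := by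
    obtain ⟨x, rfl⟩ := Submodule.mkQ_surjective _ x
    rfl
  have hf' : Function.Injective f' := by
    have : (f' : R ⧸ I → R ⧸ I) = f a ∘ Submodule.quotEquivOfEq _ _ (colon_eq a ha).symm :=
      funext hff'
    rw [this]
    exact (hf a).comp (LinearEquiv.injective _)
  have hfg' : Function.Exact f' (g a) := by
    intro y
    rw [hfg a y]
    constructor
    · rintro ⟨x, rfl⟩
      exact ⟨(Submodule.quotEquivOfEq _ _ (colon_eq a ha).symm).symm x, by rw [hff']; simp⟩
    · rintro ⟨x, rfl⟩
      exact ⟨_, (hff' x).symm⟩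
  have hS := hfg'.moduleCatShortExact hf' (hg a)
  have hzero := extVanishes_iff.1 (ih _ (sup_lt a ha) (i + 1) (by omega))
  have hbot : (⊤ : Submodule R (Ext (ModuleCat.of R (R ⧸ I)) (ModuleCat.of R N) i)) = ⊥ := by
    refine Submodule.eq_bot_of_le_smul_of_le_jacobson_bot (maximalIdeal R) _
      (Module.finite_def.1 (ModuleCat.finite_ext R _ _ i)) ?_ (maximalIdeal_le_jacobson _)
    intro e _
    obtain ⟨x, hx⟩ := Ext.contravariant_sequence_exact₁ hS _ e (add_comm 1 i) (hzero _)
    have hfa : ModuleCat.ofHom f' = a • 𝟙 (ModuleCat.of R (R ⧸ I)) := rfl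
    have hax : a • x = e := by
      rw [← hx]
      change _ = (Ext.mk₀ (ModuleCat.ofHom f')).comp x _
      rw [hfa, Ext.mk₀_smul, Ext.smul_comp, Ext.mk₀_id_comp]
    rw [← hax]
    exact Submodule.smul_mem_smul ham trivial
  exact (Submodule.subsingleton_iff R).1 (subsingleton_of_bot_eq_top hbot.symm)

/-- The injective dimension of a finite module over a Noetherian local ring is detected on the
residue field. -/
theorem of_residueField [IsLocalRing R] [IsNoetherianRing R] [Module.Finite R N]
    {n : ℕ} (h : ∀ i > n, ExtVanishes R (R ⧸ maximalIdeal R) N i)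
    (M : Type u) [AddCommGroup M] [Module R M] : ∀ i > n, ExtVanishes R M N i :=
  of_forall_quotient_ideal (quotient_ideal_of_residueField h) M

end ExtVanishes

end InjectiveDimension

/-! ### The injective dimension of a Gorenstein local ring is at most its Krull dimension -/

section Gorenstein

open RingTheory.Sequence

variable {R : Type u} [CommRing R] [IsLocalRing R] [IsNoetherianRing R]

theorem ExtVanishes.quotient_of_isWeaklyRegular {rs : List R} (reg : IsWeaklyRegular R rs)
    (mem : ∀ r ∈ rs, r ∈ maximalIdeal R) (N : Type u) [AddCommGroup N] [Module R N] :
    ∀ i > rs.length, ExtVanishes R (R ⧸ (Ideal.ofList rs • ⊤ : Submodule R R)) N i := by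
  intro i hi
  have h := ModuleCat.projectiveDimension_quotient_eq_add_length_of_isWeaklyRegular
    (ModuleCat.of R R) rs reg mem
  rw [ModuleCat.projectiveDimension_eq_zero_of_projective (ModuleCat.of R R), zero_add] at h
  have := (projectiveDimension_le_iff _ _).1 h.le
  exact HasProjectiveDimensionLT.subsingleton _ (rs.length + 1) i hi _

/-- A maximal regular sequence in `R`: its length is at most `dim R`, and the residue field embeds
into the quotient by it, as otherwise the sequence could be extended. -/
theorem exists_isRegular_injective_residueField {d : ℕ} (hd : ringKrullDim R = d) :
    ∃ rs : List R, IsWeaklyRegular R rs ∧ (∀ r ∈ rs, r ∈ maximalIdeal R) ∧ rs.length ≤ d ∧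
      ∃ f : (R ⧸ maximalIdeal R) →ₗ[R] R ⧸ (Ideal.ofList rs • ⊤ : Submodule R R),
        Function.Injective f := by
  have isRegular (rs : List R) (reg : IsWeaklyRegular R rs)
      (mem : ∀ r ∈ rs, r ∈ maximalIdeal R) : IsRegular R rs := by
    refine ⟨reg, fun htop ↦ ?_⟩
    have hle : Ideal.ofList rs ≤ maximalIdeal R := Ideal.span_le.2 mem
    rw [smul_eq_mul, Ideal.mul_top] at htop
    exact (maximalIdeal.isMaximal R).ne_top (top_le_iff.1 (htop.trans_le hle))
  have length_le (rs : List R) (reg : IsWeaklyRegular R rs)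
      (mem : ∀ r ∈ rs, r ∈ maximalIdeal R) : rs.length ≤ d := by
    have reg' := isRegular rs reg mem
    have hdim := ringKrullDim_add_length_eq_ringKrullDim_of_isRegular rs reg'
    have : Nontrivial (R ⧸ Ideal.ofList rs) := by
      refine Ideal.Quotient.nontrivial_iff.2 fun htop ↦ reg'.top_ne_smul ?_
      rw [smul_eq_mul, Ideal.mul_top, htop]
    have h0 : (0 : WithBot ℕ∞) ≤ ringKrullDim (R ⧸ Ideal.ofList rs) :=
      ringKrullDim_nonneg_of_nontrivial
    have : (rs.length : WithBot ℕ∞) ≤ d := by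
      rw [← hd, ← hdim]
      exact le_add_of_nonneg_left h0
    exact_mod_cast this
  by_contra! hcon
  have all (k : ℕ) : ∃ rs : List R, IsWeaklyRegular R rs ∧ (∀ r ∈ rs, r ∈ maximalIdeal R) ∧
      rs.length = k := by
    induction k with
    | zero => exact ⟨[], IsWeaklyRegular.nil R R, by simp, rfl⟩
    | succ k ih =>
      obtain ⟨rs, reg, mem, hlen⟩ := ih
      have hinj := hcon rs reg mem (length_le rs reg mem)
      have hsub : Subsingleton
          ((R ⧸ maximalIdeal R) →ₗ[R] R ⧸ (Ideal.ofList rs • ⊤ : Submodule R R)) := by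
        refine subsingleton_of_forall_eq 0 fun f ↦ ?_
        have : IsSimpleModule R (R ⧸ maximalIdeal R) :=
          isSimpleModule_iff_isCoatom.2 (maximalIdeal.isMaximal R).out
        exact (LinearMap.injective_or_eq_zero f).resolve_left (hinj f)
      obtain ⟨x, hx, hreg⟩ := IsSMulRegular.subsingleton_linearMap_iff.1 hsub
      rw [Ideal.annihilator_quotient] at hx
      refine ⟨rs ++ [x], ?_, ?_, by simp [hlen]⟩
      · rw [isWeaklyRegular_append_iff]
        exact ⟨reg, (isWeaklyRegular_singleton_iff _ x).2 hreg⟩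
      · simpa [or_imp, forall_and] using ⟨mem, hx⟩
  obtain ⟨rs, reg, mem, hlen⟩ := all (d + 1)
  have := length_le rs reg mem
  omega

/-- A Noetherian local ring of finite injective dimension has injective dimension at most its
Krull dimension. If `s` is the injective dimension and `k ↪ R ⧸ (x₁, …, xₜ)` for a regular sequence,
then `Ext^s(R ⧸ (x₁, …, xₜ), R) → Ext^s(k, R)` is onto, and its source vanishes for `s > t`. -/
theorem ExtVanishes.of_gt_ringKrullDim {d : ℕ} (hd : ringKrullDim R = d) {n : ℕ}
    (hn : ∀ i > n, ExtVanishes R (R ⧸ maximalIdeal R) R i)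
    (M : Type u) [AddCommGroup M] [Module R M] : ∀ i > d, ExtVanishes R M R i := by
  obtain ⟨rs, reg, mem, hlen, f, hf⟩ := exists_isRegular_injective_residueField hd
  have descend (s : ℕ) (hs : ∀ i > d + s, ExtVanishes R (R ⧸ maximalIdeal R) R i) :
      ∀ i > d, ExtVanishes R (R ⧸ maximalIdeal R) R i := by
    induction s with
    | zero => exact hs
    | succ s ih =>
      refine ih fun i hi ↦ ?_
      rcases (Nat.succ_le_iff.2 hi).eq_or_lt with rfl | hlt
      · refine sub_left hf f.exact_map_mkQ_range (LinearMap.range f).mkQ_surjective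
          (quotient_of_isWeaklyRegular reg mem R _ (by omega)) ?_
        exact of_residueField hs _ _ (by omega)
      · exact hs i (by omega)
  exact of_residueField (descend n fun i hi ↦ hn i (by omega)) M

end Gorenstein

/-! ### Regular local rings have finite global dimension -/

section Regular

open RingTheory.Sequence

/-- An element outside `𝔪²` is part of a minimal generating set of `𝔪`. -/
theorem IsLocalRing.spanFinrank_maximalIdeal_quotient_lt {R : Type u} [CommRing R] [IsLocalRing R]
    [IsNoetherianRing R] {x : R} (hx : x ∈ maximalIdeal R) (hx2 : x ∉ maximalIdeal R ^ 2)
    [IsLocalRing (R ⧸ Ideal.span {x})] :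
    (maximalIdeal (R ⧸ Ideal.span {x})).spanFinrank < (maximalIdeal R).spanFinrank := by
  classical
  obtain ⟨s, hcard, hs⟩ := Submodule.FG.exists_span_finset_card_eq_spanFinrank
    (maximalIdeal R).fg_of_isNoetherianRing
  obtain ⟨c, -, hc⟩ := Submodule.mem_span_finset.1 (hs ▸ hx)
  obtain ⟨a, has, ha⟩ : ∃ a ∈ s, c a ∉ maximalIdeal R := by
    by_contra! hcon
    refine hx2 (hc ▸ sum_mem fun a ha ↦ ?_)
    rw [pow_two]
    exact Ideal.mul_mem_mul (hcon a ha) (hs ▸ Submodule.subset_span ha)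
  have hunit : IsUnit (c a) := by simpa using ha
  have hmap : maximalIdeal (R ⧸ Ideal.span {x}) =
      Ideal.span (Ideal.Quotient.mk (Ideal.span {x}) '' (s.erase a : Finset R)) := by
    rw [← IsLocalRing.map_maximalIdeal_of_surjective (Ideal.Quotient.mk (Ideal.span {x}))
      Ideal.Quotient.mk_surjective, ← hs]
    change Ideal.map _ (Ideal.span _) = _
    rw [Ideal.map_span]
    refine le_antisymm (Ideal.span_le.2 ?_)
      (Ideal.span_mono (Set.image_mono (by simp)))
    rintro _ ⟨b, hb, rfl⟩
    by_cases hba : b = a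
    · subst hba
      have h0 : Ideal.Quotient.mk (Ideal.span {x}) (∑ a ∈ s, c a • a) = 0 :=
        Ideal.Quotient.eq_zero_iff_mem.2 (by rw [hc]; exact Ideal.mem_span_singleton_self x)
      rw [← Finset.add_sum_erase _ _ has, map_add, smul_eq_mul, map_mul] at h0
      have hu := hunit.map (Ideal.Quotient.mk (Ideal.span {x}))
      rw [SetLike.mem_coe, ← Ideal.unit_mul_mem_iff_mem _ hu, eq_neg_of_add_eq_zero_left h0, map_sum]
      refine neg_mem (sum_mem fun y hy ↦ ?_)
      rw [smul_eq_mul, map_mul]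
      exact Ideal.mul_mem_left _ _ (Ideal.subset_span ⟨y, hy, rfl⟩)
    · exact Ideal.subset_span ⟨b, by simpa [hba] using hb, rfl⟩
  rw [← hcard, hmap]
  calc _ ≤ (Ideal.Quotient.mk (Ideal.span {x}) '' (s.erase a : Finset R)).ncard :=
        Submodule.spanFinrank_span_le_ncard_of_finite ((s.erase a).finite_toSet.image _)
    _ ≤ (s.erase a).card := by
        rw [← Set.ncard_coe_finset (s.erase a)]
        exact Set.ncard_image_le (s.erase a).finite_toSet
    _ < s.card := Finset.card_erase_lt_of_mem has

/-- A regular local ring is a domain, and its maximal ideal is generated by a regular sequence.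
By induction on the dimension: prime avoidance gives `x ∈ 𝔪` outside `𝔪²` and all minimal primes;
`R ⧸ (x)` is regular of smaller dimension, so `(x)` is prime, and a minimal prime `𝔮 < (x)`
satisfies `𝔮 = x𝔮`, hence is zero. -/
theorem IsRegularLocalRing.isDomain_and_exists_isWeaklyRegular (R : Type u) [CommRing R]
    [IsRegularLocalRing R] :
    IsDomain R ∧ ∃ rs : List R, IsWeaklyRegular R rs ∧ Ideal.ofList rs = maximalIdeal R := by
  obtain ⟨n, hn⟩ : ∃ n, (maximalIdeal R).spanFinrank = n := ⟨_, rfl⟩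
  induction n using Nat.strong_induction_on generalizing R with
  | h n ih =>
  have hdim : ringKrullDim R = n := by
    rw [← IsRegularLocalRing.spanFinrank_maximalIdeal (R := R), hn]
  have hfg := (maximalIdeal R).fg_of_isNoetherianRing
  by_cases hbot : maximalIdeal R = ⊥
  · exact ⟨((IsLocalRing.isField_iff_maximalIdeal_eq).2 hbot).isDomain,
      [], IsWeaklyRegular.nil R R, by simp [hbot]⟩
  have hn0 : n ≠ 0 := fun h0 ↦ hbot ((Submodule.spanFinrank_eq_zero_iff_eq_bot hfg).1 (hn.trans h0))
  have hsq : ¬ maximalIdeal R ≤ maximalIdeal R ^ 2 := fun hle ↦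
    hbot (Submodule.eq_bot_of_le_smul_of_le_jacobson_bot (maximalIdeal R) _ hfg
      (by rwa [smul_eq_mul, ← pow_two]) (maximalIdeal_le_jacobson _))
  have hmin (q : Ideal R) (hq : q ∈ minimalPrimes R) : ¬ maximalIdeal R ≤ q := by
    intro hle
    have := hq.1.1
    have heq : maximalIdeal R = q := (maximalIdeal.isMaximal R).eq_of_le this.ne_top hle
    have hheight := IsLocalRing.maximalIdeal_height_eq_ringKrullDim (R := R)
    rw [heq, Ideal.height_eq_zero_iff.2 hq, hdim] at hheight
    exact hn0 (by exact_mod_cast hheight.symm)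
  obtain ⟨x, hxm, hx⟩ : ∃ x ∈ maximalIdeal R,
      x ∉ ⋃ q ∈ insert (maximalIdeal R ^ 2) (minimalPrimes R), (q : Set R) := by
    by_contra! hcon
    obtain ⟨q, hq, hle⟩ := (Ideal.subset_union_prime_finite
      ((minimalPrimes.finite_of_isNoetherianRing R).insert _) (f := id)
      (maximalIdeal R ^ 2) (maximalIdeal R ^ 2)
      (fun q hq h1 _ ↦ ((Set.mem_insert_iff.1 hq).resolve_left h1).1.1)).1 hcon
    rcases Set.mem_insert_iff.1 hq with rfl | hq
    · exact hsq hle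
    · exact hmin q hq hle
  simp only [Set.mem_iUnion, Set.mem_insert_iff, SetLike.mem_coe, not_exists] at hx
  have hx2 : x ∉ maximalIdeal R ^ 2 := hx _ (Or.inl rfl)
  have hne : Ideal.span {x} ≠ ⊤ := fun h ↦ (maximalIdeal.isMaximal R).ne_top
    (top_le_iff.1 (h.ge.trans ((Ideal.span_singleton_le_iff_mem _).2 hxm)))
  have : Nontrivial (R ⧸ Ideal.span {x}) := Ideal.Quotient.nontrivial_iff.2 hne
  have : IsLocalRing (R ⧸ Ideal.span {x}) :=
    IsLocalRing.of_surjective' _ Ideal.Quotient.mk_surjective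
  have hlt := IsLocalRing.spanFinrank_maximalIdeal_quotient_lt hxm hx2
  have hdim' : ringKrullDim R ≤ ringKrullDim (R ⧸ Ideal.span {x}) + 1 := by
    have h := ringKrullDim_le_ringKrullDim_quotSMulTop_succ hxm
    rwa [← Submodule.ideal_span_singleton_smul, smul_eq_mul, Ideal.mul_top] at h
  have : IsRegularLocalRing (R ⧸ Ideal.span {x}) := by
    refine IsRegularLocalRing.of_spanFinrank_maximalIdeal_le _ ?_
    rw [hn] at hlt
    have h1 : ((maximalIdeal (R ⧸ Ideal.span {x})).spanFinrank : WithBot ℕ∞) + 1 ≤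
        ringKrullDim (R ⧸ Ideal.span {x}) + 1 := by
      refine le_trans ?_ hdim'
      rw [hdim]
      exact_mod_cast hlt
    exact (ENat.WithBot.add_le_add_one_right_iff).1 h1
  obtain ⟨hdom, rs, hrs, hrs'⟩ := ih _ (hn ▸ hlt) (R ⧸ Ideal.span {x}) rfl
  have hprime : (Ideal.span {x}).IsPrime := (Ideal.Quotient.isDomain_iff_prime _).1 hdom
  obtain ⟨q, hq, hqx⟩ := Ideal.exists_minimalPrimes_le (I := ⊥) (J := Ideal.span {x}) bot_le
  have hqp := hq.1.1
  have hxq : x ∉ q := hx q (Or.inr hq)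
  have hq0 : q = ⊥ := by
    refine Submodule.eq_bot_of_le_smul_of_le_jacobson_bot (maximalIdeal R) _
      q.fg_of_isNoetherianRing (fun y hy ↦ ?_) (maximalIdeal_le_jacobson _)
    obtain ⟨z, rfl⟩ := Ideal.mem_span_singleton'.1 (hqx hy)
    rw [mul_comm]
    exact Submodule.smul_mem_smul hxm ((hqp.mem_or_mem hy).resolve_right hxq)
  have hbotp : (⊥ : Ideal R).IsPrime := hq0 ▸ hqp
  have : IsDomain R := IsDomain.of_bot_isPrime R
  have hx0 : x ≠ 0 := fun h ↦ hxq (h ▸ q.zero_mem)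
  refine ⟨this, ?_⟩
  obtain ⟨rs, rfl⟩ := List.map_surjective_iff.2 Ideal.Quotient.mk_surjective rs
  refine ⟨x :: rs, ?_, ?_⟩
  · refine (isWeaklyRegular_cons_iff R x rs).2 ⟨IsSMulRegular.of_ne_zero hx0, ?_⟩
    have e : (R ⧸ Ideal.span {x}) ≃ₗ[R] QuotSMulTop x R := Submodule.quotEquivOfEq _ _ <| by
      rw [← Submodule.ideal_span_singleton_smul, smul_eq_mul, Ideal.mul_top]
    rw [← e.isWeaklyRegular_congr]
    exact (isWeaklyRegular_map_algebraMap_iff (R ⧸ Ideal.span {x}) _ rs).1 hrs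
  · rw [← Ideal.map_ofList] at hrs'
    have := congrArg (Ideal.comap (Ideal.Quotient.mk (Ideal.span {x}))) hrs'
    rw [Ideal.comap_map_of_surjective _ Ideal.Quotient.mk_surjective, ← RingHom.ker_eq_comap_bot,
      Ideal.mk_ker] at this
    rw [Ideal.ofList_cons, sup_comm, this]
    have := IsLocalHom.of_surjective (Ideal.Quotient.mk (Ideal.span {x}))
      Ideal.Quotient.mk_surjective
    exact IsLocalRing.maximalIdeal_comap _

/-- A regular local ring has finite global dimension: its residue field has finite projective
dimension, so all finite modules have bounded injective dimension. -/
theorem IsRegularLocalRing.exists_extVanishes (R : Type u) [CommRing R] [IsRegularLocalRing R] :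
    ∃ n : ℕ, ∀ (M N : Type u) [AddCommGroup M] [Module R M] [AddCommGroup N] [Module R N]
      [Module.Finite R M], ∀ i > n, ExtVanishes R M N i := by
  obtain ⟨-, rs, reg, hrs⟩ := IsRegularLocalRing.isDomain_and_exists_isWeaklyRegular R
  have hmem (r : R) (hr : r ∈ rs) : r ∈ maximalIdeal R := hrs ▸ Ideal.subset_span hr
  have e : (R ⧸ (Ideal.ofList rs • ⊤ : Submodule R R)) ≃ₗ[R] R ⧸ maximalIdeal R :=
    Submodule.quotEquivOfEq _ _ (by rw [smul_eq_mul, Ideal.mul_top, hrs])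
  refine ⟨rs.length, fun M N _ _ _ _ _ i hi ↦ ?_⟩
  have hpd : HasProjectiveDimensionLT (ModuleCat.of R M) (rs.length + 1) := by
    refine ModuleCat.hasProjectiveDimensionLT_of_forall_finite _ _ fun L _ ↦ ?_
    exact ExtVanishes.of_residueField (N := L) (n := rs.length)
      (fun i hi ↦ (ExtVanishes.quotient_of_isWeaklyRegular reg hmem L i hi).congr_left e) M _
      (Nat.lt_succ_self _)
  exact HasProjectiveDimensionLT.subsingleton _ _ i hi _

end Regular

/-! ### Duality for modules with `Ext^i(X, R) = 0` for all `i > 0` -/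

section Duality

open TensorProduct

variable {R : Type u} [CommRing R]

theorem ExtVanishes.lcomp_surjective {A B C N : Type u} [AddCommGroup A] [Module R A]
    [AddCommGroup B] [Module R B] [AddCommGroup C] [Module R C] [AddCommGroup N] [Module R N]
    {f : A →ₗ[R] B} {g : B →ₗ[R] C} (hf : Function.Injective f) (h : Function.Exact f g)
    (hg : Function.Surjective g) (hC : ExtVanishes R C N 1) :
    Function.Surjective (f.lcomp R N) :=
  fun φ ↦ extends_of_one hf h hg hC φ

theorem Module.Injective.exists_comp_eq {A B E : Type u} [AddCommGroup A] [Module R A]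
    [AddCommGroup B] [Module R B] [AddCommGroup E] [Module R E] [Module.Injective R E]
    {f : A →ₗ[R] B} (hf : Function.Injective f) (φ : A →ₗ[R] E) : ∃ ψ : B →ₗ[R] E, ψ ∘ₗ f = φ := by
  obtain ⟨ψ, hψ⟩ := Module.Injective.out f hf φ
  exact ⟨ψ, LinearMap.ext hψ⟩

theorem LinearMap.exact_compRight {X A B C : Type u} [AddCommGroup X] [Module R X]
    [AddCommGroup A] [Module R A] [AddCommGroup B] [Module R B] [AddCommGroup C] [Module R C]
    {f : A →ₗ[R] B} {g : B →ₗ[R] C} (hf : Function.Injective f) (h : Function.Exact f g) :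
    Function.Exact (f.compRight R (M := X)) (g.compRight R (M := X)) := by
  intro φ
  constructor
  · intro hφ
    have hmem (x : X) : φ x ∈ LinearMap.range f := (h _).1 (LinearMap.congr_fun hφ x)
    refine ⟨(LinearEquiv.ofInjective f hf).symm ∘ₗ φ.codRestrict _ hmem, ?_⟩
    ext x
    exact congrArg Subtype.val
      ((LinearEquiv.ofInjective f hf).apply_symm_apply (φ.codRestrict _ hmem x))
  · rintro ⟨ψ, rfl⟩
    ext x
    exact h.apply_apply_eq_zero _

/-- The evaluation map `X ⊗ N → Hom(X*, N)`. -/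
noncomputable def tensorDualHom (X N : Type u) [AddCommGroup X] [Module R X] [AddCommGroup N]
    [Module R N] : X ⊗[R] N →ₗ[R] Module.Dual R X →ₗ[R] N :=
  dualTensorHom R (Module.Dual R X) N ∘ₗ (Module.Dual.eval R X).rTensor N

@[simp]
theorem tensorDualHom_tmul (X N : Type u) [AddCommGroup X] [Module R X] [AddCommGroup N]
    [Module R N] (x : X) (y : N) (φ : Module.Dual R X) :
    tensorDualHom X N (x ⊗ₜ[R] y) φ = φ x • y := by
  simp [tensorDualHom]

theorem tensorDualHom_naturality {X Y N : Type u} [AddCommGroup X] [Module R X] [AddCommGroup Y]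
    [Module R Y] [AddCommGroup N] [Module R N] (f : X →ₗ[R] Y) (t : X ⊗[R] N) :
    tensorDualHom Y N (f.rTensor N t) = tensorDualHom X N t ∘ₗ f.dualMap := by
  induction t with
  | zero => simp
  | tmul x y => ext φ; simp
  | add s t hs ht => rw [map_add, map_add, hs, ht, map_add, LinearMap.add_comp]

theorem tensorDualHom_bijective_of_free (F N : Type u) [AddCommGroup F] [Module R F]
    [Module.Free R F] [Module.Finite R F] [AddCommGroup N] [Module R N] :
    Function.Bijective (tensorDualHom (R := R) F N) := by
  have h : (tensorDualHom (R := R) F N : _ → _) =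
      dualTensorHomEquiv R (Module.Dual R F) N ∘ (Module.evalEquiv R F).rTensor N := by
    ext t : 1
    rfl
  rw [h]
  exact (LinearEquiv.bijective _).comp (LinearEquiv.bijective _)

variable (R) in
/-- `X` is a finite module with `Ext^i(X, R) = 0` for all `i > 0`. Over a Gorenstein local ring
these are the maximal Cohen–Macaulay modules (including `0`). -/
structure ExtOrthogonal (X : Type u) [AddCommGroup X] [Module R X] : Prop where
  finite : Module.Finite R X
  extVanishes (i : ℕ) : ExtVanishes R X R (i + 1)

namespace ExtOrthogonal

variable {X : Type u} [AddCommGroup X] [Module R X]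

theorem ker {F : Type u} [AddCommGroup F] [Module R F] [IsNoetherianRing R] [Module.Finite R F]
    [Module.Projective R F] (hX : ExtOrthogonal R X) {g : F →ₗ[R] X}
    (hg : Function.Surjective g) : ExtOrthogonal R (LinearMap.ker g) where
  finite := inferInstance
  extVanishes i := (ExtVanishes.succ_iff (LinearMap.ker g).subtype_injective
    (LinearMap.exact_subtype_ker_map g) hg i).1 (hX.extVanishes (i + 1))

section Dual

variable {n : ℕ} {g : (Fin n → R) →ₗ[R] X}

theorem dualMap_injective (hg : Function.Surjective g) : Function.Injective g.dualMap :=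
  LinearMap.dualMap_injective_of_surjective hg

theorem dualMap_exact (hg : Function.Surjective g) :
    Function.Exact g.dualMap (LinearMap.ker g).subtype.dualMap :=
  LinearMap.exact_lcomp_of_exact_of_surjective R (LinearMap.exact_subtype_ker_map g) hg

theorem dualMap_surjective (hX : ExtOrthogonal R X) (hg : Function.Surjective g) :
    Function.Surjective (LinearMap.ker g).subtype.dualMap :=
  ExtVanishes.lcomp_surjective (LinearMap.ker g).subtype_injective
    (LinearMap.exact_subtype_ker_map g) hg (hX.extVanishes 0)

end Dual

section Bijective

variable {N : Type u} [AddCommGroup N] [Module R N]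

theorem eventually_extVanishes_dual_ker (hX : ExtOrthogonal R X)
    (hk : ∃ k, ∀ i ≥ k, ExtVanishes R (Module.Dual R X) N i) {n : ℕ} {g : (Fin n → R) →ₗ[R] X}
    (hg : Function.Surjective g) :
    ∃ k, ∀ i ≥ k, ExtVanishes R (Module.Dual R (LinearMap.ker g)) N i := by
  obtain ⟨k, hk⟩ := hk
  refine ⟨k + 1, fun i hi ↦ ?_⟩
  obtain ⟨i, rfl⟩ : ∃ j, i = j + 1 := ⟨i - 1, by omega⟩
  exact ExtVanishes.quotient_left (dualMap_injective hg) (dualMap_exact hg)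
    (hX.dualMap_surjective hg) (hk i (by omega)) (ExtVanishes.of_projective R N _ i)

/-- A map `X* → N` extends along the inclusion of `X*` in a free module `F*`, because
`Ext¹` of the cosyzygy into `N` vanishes; and the statement is clear for `F`. -/
theorem tensorDualHom_surjective (hX : ExtOrthogonal R X) {n : ℕ} {g : (Fin n → R) →ₗ[R] X}
    (hg : Function.Surjective g) (h1 : ExtVanishes R (Module.Dual R (LinearMap.ker g)) N 1) :
    Function.Surjective (tensorDualHom (R := R) X N) := by
  intro τ
  obtain ⟨σ, hσ⟩ := ExtVanishes.extends_of_one (dualMap_injective hg) (dualMap_exact hg)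
    (hX.dualMap_surjective hg) h1 τ
  obtain ⟨s, rfl⟩ := (tensorDualHom_bijective_of_free (R := R) (Fin n → R) N).2 σ
  exact ⟨g.rTensor N s, by rw [tensorDualHom_naturality, hσ]⟩

/-- A diagram chase, comparing `Y ⊗ N → F ⊗ N → X ⊗ N → 0` with
`0 → Hom(X*, N) → Hom(F*, N) → Hom(Y*, N)` for the syzygy `Y` of `X` in a free module `F`. -/
theorem tensorDualHom_injective (hX : ExtOrthogonal R X) {n : ℕ} {g : (Fin n → R) →ₗ[R] X}
    (hg : Function.Surjective g)
    (hK : Function.Surjective (tensorDualHom (R := R) (LinearMap.ker g) N)) :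
    Function.Injective (tensorDualHom (R := R) X N) := by
  refine (injective_iff_map_eq_zero _).2 fun t ht ↦ ?_
  obtain ⟨s, rfl⟩ := LinearMap.rTensor_surjective N hg t
  rw [tensorDualHom_naturality] at ht
  obtain ⟨τ, hτ⟩ := (LinearMap.exact_lcomp_of_exact_of_surjective N (dualMap_exact hg)
    (hX.dualMap_surjective hg) _).1 ht
  obtain ⟨w, rfl⟩ := hK τ
  have hw : s = (LinearMap.ker g).subtype.rTensor N w := by
    refine (tensorDualHom_bijective_of_free (R := R) (Fin n → R) N).1 ?_
    rw [tensorDualHom_naturality]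
    exact hτ.symm
  rw [hw, ← LinearMap.comp_apply, ← LinearMap.rTensor_comp]
  simp [LinearMap.comp_ker_subtype]

end Bijective

variable [IsNoetherianRing R]

/-- Cosyzygy shifting: if, on the duals of modules orthogonal to `R`, eventual vanishing of
`Ext^i(-, N)` implies vanishing in all degrees above a fixed `n`, then it implies vanishing in all
positive degrees. Indeed for a syzygy `Y` of `X` the dual `Y*` is a cosyzygy of `X*`, so
`Ext^i(X*, N) = Ext^{i+1}(Y*, N)`. -/
theorem extVanishes_dual_of_bounded {N : Type u} [AddCommGroup N] [Module R N] {n : ℕ}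
    (hP : ∀ (X : Type u) [AddCommGroup X] [Module R X], ExtOrthogonal R X →
      (∃ k, ∀ i ≥ k, ExtVanishes R (Module.Dual R X) N i) →
      ∀ i > n, ExtVanishes R (Module.Dual R X) N i)
    (hX : ExtOrthogonal R X) (hk : ∃ k, ∀ i ≥ k, ExtVanishes R (Module.Dual R X) N i) (i : ℕ) :
    ExtVanishes R (Module.Dual R X) N (i + 1) := by
  suffices ∀ (k : ℕ) (X : Type u) [AddCommGroup X] [Module R X], ExtOrthogonal R X →
      (∃ k, ∀ i ≥ k, ExtVanishes R (Module.Dual R X) N i) →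
      ∀ i, i + 1 + k > n → ExtVanishes R (Module.Dual R X) N (i + 1) from
    this n X hX hk i (by omega)
  intro k
  induction k with
  | zero => exact fun X _ _ hX hk i hi ↦ hP X hX hk _ hi
  | succ k ih =>
    intro X _ _ hX hk i hi
    have := hX.finite
    obtain ⟨r, g, hg, -⟩ := Module.Finite.exists_presentation (R := R) X
    have h1 := dualMap_injective hg
    have h2 := dualMap_exact hg
    have h3 := hX.dualMap_surjective hg
    refine ExtVanishes.sub_left h1 h2 h3 (ExtVanishes.of_projective R N _ i) ?_
    refine ih (LinearMap.ker g) (hX.ker hg) (hX.eventually_extVanishes_dual_ker hk hg)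
      (i + 1) (by omega)

theorem dual {d : ℕ}
    (hd : ∀ (M : Type u) [AddCommGroup M] [Module R M], ∀ i > d, ExtVanishes R M R i)
    (hX : ExtOrthogonal R X) : ExtOrthogonal R (Module.Dual R X) where
  finite := have := hX.finite; inferInstance
  extVanishes := extVanishes_dual_of_bounded (n := d) (fun _ _ _ _ _ ↦ hd _) hX
    ⟨d + 1, fun i hi ↦ hd _ i hi⟩

section Bijective

variable {N : Type u} [AddCommGroup N] [Module R N]

theorem tensorDualHom_bijective
    (hN : ∀ (X : Type u) [AddCommGroup X] [Module R X], ExtOrthogonal R X →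
      (∃ k, ∀ i ≥ k, ExtVanishes R (Module.Dual R X) N i) →
      ∀ i, ExtVanishes R (Module.Dual R X) N (i + 1))
    (hX : ExtOrthogonal R X) (hk : ∃ k, ∀ i ≥ k, ExtVanishes R (Module.Dual R X) N i) :
    Function.Bijective (tensorDualHom (R := R) X N) := by
  have surj (Y : Type u) [AddCommGroup Y] [Module R Y] (hY : ExtOrthogonal R Y)
      (hYk : ∃ k, ∀ i ≥ k, ExtVanishes R (Module.Dual R Y) N i) :
      Function.Surjective (tensorDualHom (R := R) Y N) := by
    have := hY.finite
    obtain ⟨r, g, hg, -⟩ := Module.Finite.exists_presentation (R := R) Y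
    exact hY.tensorDualHom_surjective hg
      (hN _ (hY.ker hg) (hY.eventually_extVanishes_dual_ker hYk hg) 0)
  have := hX.finite
  obtain ⟨r, g, hg, -⟩ := Module.Finite.exists_presentation (R := R) X
  exact ⟨hX.tensorDualHom_injective hg
    (surj _ (hX.ker hg) (hX.eventually_extVanishes_dual_ker hk hg)), surj X hX hk⟩

end Bijective

theorem eval_bijective {d : ℕ}
    (hd : ∀ (M : Type u) [AddCommGroup M] [Module R M], ∀ i > d, ExtVanishes R M R i)
    (hX : ExtOrthogonal R X) : Function.Bijective (Module.Dual.eval R X) := by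
  have h := hX.tensorDualHom_bijective (N := R) (fun Y _ _ hY _ ↦ (hY.dual hd).extVanishes)
    ⟨d + 1, fun i hi ↦ hd _ i hi⟩
  have heq : (Module.Dual.eval R X : X → _) =
      tensorDualHom (R := R) X R ∘ (TensorProduct.rid R X).symm := by
    ext x φ
    simp
  rw [heq]
  exact h.comp (LinearEquiv.bijective _)

section Injective

variable {N : Type u} [AddCommGroup N] [Module R N]

/-- If `E` is injective, `Ext^i(N, Hom(X, E))` vanishes for `i > 0`: for a syzygy `Y` of `X` in `F`
the map `Y ⊗ N → F ⊗ N` is injective, as it is identified with the inclusion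
`Hom(Y*, N) → Hom(F*, N)`. -/
theorem extVanishes_hom_of_injective {E : Type u} [AddCommGroup E] [Module R E]
    [Module.Injective R E]
    (hN : ∀ (X : Type u) [AddCommGroup X] [Module R X], ExtOrthogonal R X →
      (∃ k, ∀ i ≥ k, ExtVanishes R (Module.Dual R X) N i) →
      ∀ i, ExtVanishes R (Module.Dual R X) N (i + 1))
    (hX : ExtOrthogonal R X) (hk : ∃ k, ∀ i ≥ k, ExtVanishes R (Module.Dual R X) N i) (i : ℕ) :
    ExtVanishes R N (X →ₗ[R] E) (i + 1) := by
  induction i generalizing X with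
  | zero =>
    have := hX.finite
    obtain ⟨r, g, hg, -⟩ := Module.Finite.exists_presentation (R := R) X
    have hY := hX.ker hg
    have hinj : Function.Injective ((LinearMap.ker g).subtype.rTensor N) := by
      have hbij := hY.tensorDualHom_bijective hN (hX.eventually_extVanishes_dual_ker hk hg)
      refine Function.Injective.of_comp (f := tensorDualHom (R := R) (Fin r → R) N) ?_
      have heq : tensorDualHom (R := R) (Fin r → R) N ∘ (LinearMap.ker g).subtype.rTensor N =
          (LinearMap.ker g).subtype.dualMap.lcomp R N ∘ tensorDualHom (LinearMap.ker g) N :=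
        funext fun t ↦ tensorDualHom_naturality _ t
      rw [heq]
      exact (LinearMap.lcomp_injective_of_surjective _ (hX.dualMap_surjective hg)).comp hbij.1
    refine ExtVanishes.one_of_lifts (f := g.lcomp R E) (g := (LinearMap.ker g).subtype.lcomp R E)
      (LinearMap.lcomp_injective_of_surjective _ hg)
      (LinearMap.exact_lcomp_of_exact_of_surjective E (LinearMap.exact_subtype_ker_map g) hg)
      ?_ ?_ ?_
    · exact Module.Injective.exists_comp_eq (LinearMap.ker g).subtype_injective
    · exact ((ExtVanishes.of_injective R N E 0).pi_right E r).congr_right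
        (LinearEquiv.piRing R E (Fin r) R).symm
    · intro φ
      obtain ⟨ψ, hψ⟩ := Module.Injective.exists_comp_eq (R := R)
        (A := LinearMap.ker g ⊗[R] N) (B := (Fin r → R) ⊗[R] N) (E := E) hinj
        (TensorProduct.lift φ.flip)
      refine ⟨(TensorProduct.curry ψ).flip, ?_⟩
      ext y k
      exact LinearMap.congr_fun hψ (k ⊗ₜ y)
  | succ i ih =>
    have := hX.finite
    obtain ⟨r, g, hg, -⟩ := Module.Finite.exists_presentation (R := R) X
    refine ExtVanishes.sub_right (f := g.lcomp R E) (g := (LinearMap.ker g).subtype.lcomp R E)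
      (LinearMap.lcomp_injective_of_surjective _ hg)
      (LinearMap.exact_lcomp_of_exact_of_surjective E (LinearMap.exact_subtype_ker_map g) hg)
      ?_ (ih (hX.ker hg) (hX.eventually_extVanishes_dual_ker hk hg)) ?_
    · exact Module.Injective.exists_comp_eq (LinearMap.ker g).subtype_injective
    · exact ((ExtVanishes.of_injective R N E (i + 1)).pi_right E r).congr_right
        (LinearEquiv.piRing R E (Fin r) R).symm

/-- The previous vanishing passes to modules `W` of finite injective dimension with
`Ext^i(X, W) = 0` for all `i > 0`, by dimension shifting in `W`. -/
theorem extVanishes_hom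
    (hN : ∀ (X : Type u) [AddCommGroup X] [Module R X], ExtOrthogonal R X →
      (∃ k, ∀ i ≥ k, ExtVanishes R (Module.Dual R X) N i) →
      ∀ i, ExtVanishes R (Module.Dual R X) N (i + 1))
    (hX : ExtOrthogonal R X) (hk : ∃ k, ∀ i ≥ k, ExtVanishes R (Module.Dual R X) N i)
    {d : ℕ} (W : Type u) [AddCommGroup W] [Module R W]
    (hd : ∀ (M : Type u) [AddCommGroup M] [Module R M], ∀ i > d, ExtVanishes R M W i)
    (hW : ∀ i, ExtVanishes R X W (i + 1)) :
    ∀ i > d, ExtVanishes R N (X →ₗ[R] W) i := by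
  induction d generalizing W with
  | zero =>
    have := ExtVanishes.injective_of_quotient_ideal fun I ↦ hd (R ⧸ I) 1 one_pos
    intro i hi
    obtain ⟨i, rfl⟩ : ∃ j, i = j + 1 := ⟨i - 1, by omega⟩
    exact hX.extVanishes_hom_of_injective hN hk i
  | succ d ih =>
    obtain ⟨E, _, _, f, hE, hf⟩ := Module.exists_injective_embedding (R := R) W
    have hex : Function.Exact f (LinearMap.range f).mkQ := f.exact_map_mkQ_range
    have hg := (LinearMap.range f).mkQ_surjective
    have key := ih (E ⧸ LinearMap.range f)
      (fun M _ _ i hi ↦ by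
        obtain ⟨i, rfl⟩ : ∃ j, i = j + 1 := ⟨i - 1, by omega⟩
        exact ExtVanishes.quotient_right hf hex hg (ExtVanishes.of_injective R M E i)
          (hd M _ (by omega)))
      (fun i ↦ ExtVanishes.quotient_right hf hex hg (ExtVanishes.of_injective R X E i) (hW _))
    intro i hi
    obtain ⟨i, rfl⟩ : ∃ j, i = j + 1 := ⟨i - 1, by omega⟩
    refine ExtVanishes.sub_right (f := f.compRight R (M := X))
      (g := (LinearMap.range f).mkQ.compRight R (M := X)) ?_ ?_ ?_
      (key i (by omega)) (hX.extVanishes_hom_of_injective hN hk i)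
    · exact fun φ ψ h ↦ LinearMap.ext fun x ↦ hf (LinearMap.congr_fun h x)
    · exact LinearMap.exact_compRight hf hex
    · exact ExtVanishes.lifts_of_one hf hex hg (hW 0)

end Injective

end ExtOrthogonal

section Main

variable [IsNoetherianRing R]

/-- Symmetry of the vanishing of `Ext` over a Noetherian ring of finite self-injective dimension,
given a uniform bound on the finite values of `sup {i | Ext^i(M, N) ≠ 0}` for fixed `N`.
A high syzygy `Z` of `M` is orthogonal to `R`, and `Z ≅ Hom(Z*, R)`; the conclusion for `Z` gives
that for `M`, because `Ext^i(N, R) = 0` for `i > d`. -/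
theorem ExtVanishes.symm_of_bounded {N : Type u} [AddCommGroup N] [Module R N] {d n : ℕ}
    (hd : ∀ (M : Type u) [AddCommGroup M] [Module R M], ∀ i > d, ExtVanishes R M R i)
    (hn : ∀ (M : Type u) [AddCommGroup M] [Module R M] [Module.Finite R M],
      (∃ k, ∀ i ≥ k, ExtVanishes R M N i) → ∀ i > n, ExtVanishes R M N i)
    (M : Type u) [AddCommGroup M] [Module R M] [Module.Finite R M]
    (hM : ∃ k, ∀ i ≥ k, ExtVanishes R M N i) : ∀ i > d, ExtVanishes R N M i := by
  have hN (X : Type u) [AddCommGroup X] [Module R X] (hX : ExtOrthogonal R X)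
      (hk : ∃ k, ∀ i ≥ k, ExtVanishes R (Module.Dual R X) N i) (i : ℕ) :
      ExtVanishes R (Module.Dual R X) N (i + 1) :=
    hX.extVanishes_dual_of_bounded
      (fun Y _ _ hY h ↦ have := (hY.dual hd).finite; hn _ h) hk i
  suffices ∀ (s : ℕ) (M : Type u) [AddCommGroup M] [Module R M] [Module.Finite R M],
      (∃ k, ∀ i ≥ k, ExtVanishes R M N i) → (∀ i > s, ExtVanishes R M R i) →
      ∀ i > d, ExtVanishes R N M i from this d M hM (hd M)
  intro s
  induction s with
  | zero =>
    intro M _ _ _ ⟨k, hk⟩ hR i hi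
    have hZ : ExtOrthogonal R M := ⟨inferInstance, fun i ↦ hR _ (by omega)⟩
    have e := LinearEquiv.ofBijective _ (hZ.eval_bijective hd)
    have hX := hZ.dual hd
    refine ((hX.extVanishes_hom hN ⟨k, fun i hi ↦ (hk i hi).congr_left e⟩ R hd
      hX.extVanishes i hi).congr_right e.symm)
  | succ s ih =>
    intro M _ _ _ ⟨k, hk⟩ hR i hi
    obtain ⟨r, g, hg, _⟩ := Module.Finite.exists_presentation (R := R) M
    have hi' := (LinearMap.ker g).subtype_injective
    have hex := LinearMap.exact_subtype_ker_map g
    refine quotient_right hi' hex hg ((hd N i hi).pi_right R r) ?_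
    refine ih (LinearMap.ker g) ⟨k + 1, fun j hj ↦ ?_⟩ (fun j hj ↦ ?_) (i + 1) (by omega)
    all_goals obtain ⟨j, rfl⟩ : ∃ l, j = l + 1 := ⟨j - 1, by omega⟩
    · exact sub_left hi' hex hg (of_projective R N _ j) (hk _ (by omega))
    · exact sub_left hi' hex hg (of_projective R R _ j) (hR _ (by omega))

end Main

end Duality

/-! ### `Ext` over `A` and over `A ⧸ (x)` -/

section ChangeOfRings

open Pointwise

variable {A : Type u} [CommRing A] {x : A}

theorem IsSMulRegular.pi_const {n : ℕ} (hx : IsSMulRegular A x) :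
    IsSMulRegular (Fin n → A) x :=
  fun _ _ h ↦ funext fun i ↦ hx (congrFun h i)

theorem Module.exists_free_presentation {R : Type u} [CommRing R] (M : Type u) [AddCommGroup M]
    [Module R M] : ∃ (F : Type u) (_ : AddCommGroup F) (_ : Module R F) (_ : Module.Free R F)
      (g : F →ₗ[R] M), Function.Surjective g :=
  ⟨M →₀ R, inferInstance, inferInstance, inferInstance, Finsupp.linearCombination R id,
    Finsupp.linearCombination_id_surjective R M⟩

namespace QuotSMulTop

variable {L P N : Type u} [AddCommGroup L] [Module A L] [AddCommGroup P] [Module A P]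
  [AddCommGroup N] [Module A N]

theorem mk_eq_zero_iff {l : L} :
    (Submodule.Quotient.mk l : QuotSMulTop x L) = 0 ↔ ∃ l' : L, x • l' = l := by
  rw [Submodule.Quotient.mk_eq_zero, Submodule.mem_smul_pointwise_iff_exists]
  simp

/-- `QuotSMulTop.map` as a linear map over the quotient ring. -/
def mapQuotient (f : L →ₗ[A] P) :
    QuotSMulTop x L →ₗ[A ⧸ Ideal.span {x}] QuotSMulTop x P :=
  (QuotSMulTop.map x f).extendScalarsOfSurjective Ideal.Quotient.mk_surjective

theorem mapQuotient_injective {K : Type u} [AddCommGroup K] [Module A K] {f : K →ₗ[A] P}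
    {g : P →ₗ[A] L} (hf : Function.Injective f) (h : Function.Exact f g)
    (hL : IsSMulRegular L x) : Function.Injective (mapQuotient (x := x) f) := by
  refine (injective_iff_map_eq_zero _).2 fun k hk ↦ ?_
  obtain ⟨k, rfl⟩ := Submodule.mkQ_surjective _ k
  obtain ⟨p, hp⟩ := mk_eq_zero_iff.1 hk
  have hp : x • p = f k := hp
  have hgp : g p = 0 := hL.right_eq_zero_of_smul (by
    rw [← map_smul, hp, h.apply_apply_eq_zero])
  obtain ⟨k', rfl⟩ := (h p).1 hgp
  exact mk_eq_zero_iff.2 ⟨k', hf (by rw [map_smul, hp])⟩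

theorem mapQuotient_exact {K : Type u} [AddCommGroup K] [Module A K] {f : K →ₗ[A] P}
    {g : P →ₗ[A] L} (h : Function.Exact f g) (hg : Function.Surjective g) :
    Function.Exact (mapQuotient (x := x) f) (mapQuotient (x := x) g) :=
  QuotSMulTop.map_exact x h hg

theorem mapQuotient_surjective {g : P →ₗ[A] L} (hg : Function.Surjective g) :
    Function.Surjective (mapQuotient (x := x) g) :=
  QuotSMulTop.map_surjective x hg

variable [Module (A ⧸ Ideal.span {x}) N] [IsScalarTower A (A ⧸ Ideal.span {x}) N]

theorem smul_eq_zero_of_quotient (y : N) : x • y = 0 := by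
  rw [← algebraMap_smul (A ⧸ Ideal.span {x}) x y]
  have : algebraMap A (A ⧸ Ideal.span {x}) x = 0 :=
    Ideal.Quotient.eq_zero_iff_mem.2 (Ideal.mem_span_singleton_self x)
  rw [this, zero_smul]

theorem exists_lift (φ : L →ₗ[A] N) :
    ∃ ψ : QuotSMulTop x L →ₗ[A ⧸ Ideal.span {x}] N,
      ∀ l, ψ (Submodule.Quotient.mk l) = φ l := by
  refine ⟨(Submodule.liftQ _ φ ?_).extendScalarsOfSurjective Ideal.Quotient.mk_surjective,
    fun l ↦ rfl⟩
  intro l hl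
  obtain ⟨l, -, rfl⟩ := (Submodule.mem_smul_pointwise_iff_exists _ _ _).1 hl
  rw [LinearMap.mem_ker, map_smul, smul_eq_zero_of_quotient]

end QuotSMulTop

namespace ExtVanishes

/-- If `x` is regular on `A` and on `L`, then `Ext_A(L, N) = Ext_{A ⧸ (x)}(L ⧸ xL, N)` for every
`A ⧸ (x)`-module `N`. -/
theorem quotSMulTop_iff (hx : IsSMulRegular A x) {L N : Type u} [AddCommGroup L] [Module A L]
    [AddCommGroup N] [Module A N] [Module (A ⧸ Ideal.span {x}) N]
    [IsScalarTower A (A ⧸ Ideal.span {x}) N] (hL : IsSMulRegular L x) (i : ℕ) :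
    ExtVanishes (A ⧸ Ideal.span {x}) (QuotSMulTop x L) N (i + 1) ↔
      ExtVanishes A L N (i + 1) := by
  induction i generalizing L with
  | zero =>
    obtain ⟨F, _, _, _, g, hg⟩ := Module.exists_free_presentation (R := A) L
    have hi := (LinearMap.ker g).subtype_injective
    have hex := LinearMap.exact_subtype_ker_map g
    rw [zero_add, one_iff hi hex hg,
      one_iff (QuotSMulTop.mapQuotient_injective hi hex hL) (QuotSMulTop.mapQuotient_exact hex hg)
        (QuotSMulTop.mapQuotient_surjective hg)]
    constructor
    · intro h φ
      obtain ⟨φ', hφ'⟩ := QuotSMulTop.exists_lift (x := x) φ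
      obtain ⟨ψ', hψ'⟩ := h φ'
      refine ⟨ψ'.restrictScalars A ∘ₗ Submodule.mkQ _, ?_⟩
      ext k
      rw [← hφ', ← hψ']
      rfl
    · intro h φ'
      obtain ⟨ψ, hψ⟩ := h (φ'.restrictScalars A ∘ₗ Submodule.mkQ _)
      obtain ⟨ψ', hψ'⟩ := QuotSMulTop.exists_lift (x := x) ψ
      refine ⟨ψ', LinearMap.ext fun k ↦ ?_⟩
      obtain ⟨k, rfl⟩ := Submodule.mkQ_surjective _ k
      exact (hψ' _).trans (LinearMap.congr_fun hψ k)
  | succ i ih =>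
    obtain ⟨F, _, _, _, g, hg⟩ := Module.exists_free_presentation (R := A) L
    have hi := (LinearMap.ker g).subtype_injective
    have hex := LinearMap.exact_subtype_ker_map g
    have hK : IsSMulRegular (LinearMap.ker g) x := by
      have hF : IsSMulRegular F x :=
        Module.Flat.isSMulRegular_of_isRegular ((Commute.isRegular_iff (Commute.all x)).2 hx)
      exact fun a b h ↦ Subtype.ext (hF (congrArg Subtype.val h))
    rw [succ_iff hi hex hg,
      succ_iff (QuotSMulTop.mapQuotient_injective hi hex hL) (QuotSMulTop.mapQuotient_exact hex hg)
        (QuotSMulTop.mapQuotient_surjective hg)]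
    exact ih hK

/-- The two-step periodicity between `Ext` over `B = A ⧸ (x)` and over `A`. For `0 → L → F → M → 0`
with `F` free over `A`, reduction modulo `x` gives an exact sequence
`0 → M → L ⧸ xL → F ⧸ xF → M → 0` over `B`, whose second term satisfies
`Ext_B^{i+1}(L ⧸ xL, N) = Ext_A^{i+2}(M, N)`. -/
theorem quotient_periodicity [IsNoetherianRing A] (hx : IsSMulRegular A x) {M N : Type u}
    [AddCommGroup M] [Module A M] [Module (A ⧸ Ideal.span {x}) M]
    [IsScalarTower A (A ⧸ Ideal.span {x}) M] [Module.Finite A M]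
    [AddCommGroup N] [Module A N] [Module (A ⧸ Ideal.span {x}) N]
    [IsScalarTower A (A ⧸ Ideal.span {x}) N] (i : ℕ) :
    (ExtVanishes A M N (i + 2) → ExtVanishes (A ⧸ Ideal.span {x}) M N (i + 3) →
      ExtVanishes (A ⧸ Ideal.span {x}) M N (i + 1)) ∧
    (ExtVanishes (A ⧸ Ideal.span {x}) M N (i + 1) →
      ExtVanishes (A ⧸ Ideal.span {x}) M N (i + 2) → ExtVanishes A M N (i + 2)) := by
  obtain ⟨r, g, hg, -⟩ := Module.Finite.exists_presentation (R := A) M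
  let L := LinearMap.ker g
  have hP : IsSMulRegular (Fin r → A) x := hx.pi_const
  have hL : IsSMulRegular L x := fun a b h ↦ Subtype.ext (hP (congrArg Subtype.val h))
  have hxg (p : Fin r → A) : x • p ∈ L := by
    rw [LinearMap.mem_ker, map_smul, QuotSMulTop.smul_eq_zero_of_quotient]
  -- the quotient map `F ⧸ xF → M` and its kernel
  obtain ⟨g', hg'⟩ := QuotSMulTop.exists_lift (x := x) g
  have hg'surj : Function.Surjective g' := fun m ↦ by
    obtain ⟨p, rfl⟩ := hg m
    exact ⟨_, hg' p⟩
  let q : QuotSMulTop x L →ₗ[A ⧸ Ideal.span {x}] LinearMap.ker g' :=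
    (QuotSMulTop.mapQuotient L.subtype).codRestrict _ fun l ↦ by
      obtain ⟨l, rfl⟩ := Submodule.mkQ_surjective _ l
      exact (hg' _).trans l.2
  have hq : Function.Surjective q := by
    rintro ⟨p, hp⟩
    obtain ⟨p, rfl⟩ := Submodule.mkQ_surjective _ p
    exact ⟨Submodule.Quotient.mk ⟨p, (hg' p).symm.trans hp⟩, rfl⟩
  -- the map `M → L ⧸ xL` induced by multiplication by `x` on `F`
  let jP : (Fin r → A) →ₗ[A] QuotSMulTop x L :=
    Submodule.mkQ _ ∘ₗ (LinearMap.lsmul A (Fin r → A) x).codRestrict L hxg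
  have hjP : LinearMap.ker g ≤ LinearMap.ker jP := fun p hp ↦
    QuotSMulTop.mk_eq_zero_iff.2 ⟨⟨p, hp⟩, rfl⟩
  let jA : M →ₗ[A] QuotSMulTop x L :=
    (LinearMap.ker g).liftQ jP hjP ∘ₗ (g.quotKerEquivOfSurjective hg).symm
  let j : M →ₗ[A ⧸ Ideal.span {x}] QuotSMulTop x L :=
    jA.extendScalarsOfSurjective Ideal.Quotient.mk_surjective
  have hj (p : Fin r → A) : j (g p) = Submodule.Quotient.mk ⟨x • p, hxg p⟩ := by
    have : (g.quotKerEquivOfSurjective hg).symm (g p) = Submodule.Quotient.mk p := by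
      rw [LinearEquiv.symm_apply_eq]
      rfl
    change (LinearMap.ker g).liftQ jP hjP ((g.quotKerEquivOfSurjective hg).symm (g p)) = _
    rw [this]
    rfl
  have hjinj : Function.Injective j := by
    refine (injective_iff_map_eq_zero _).2 fun m hm ↦ ?_
    obtain ⟨p, rfl⟩ := hg m
    rw [hj] at hm
    obtain ⟨l, hl⟩ := QuotSMulTop.mk_eq_zero_iff.1 hm
    have : (l : Fin r → A) = p := hP (congrArg Subtype.val hl)
    exact this ▸ l.2
  have hjq : Function.Exact j q := by
    intro l
    obtain ⟨l, rfl⟩ := Submodule.mkQ_surjective _ l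
    constructor
    · intro h
      obtain ⟨p, hp⟩ := QuotSMulTop.mk_eq_zero_iff.1 (congrArg Subtype.val h)
      refine ⟨g p, (hj p).trans ?_⟩
      exact congrArg _ (Subtype.ext hp)
    · rintro ⟨m, hm⟩
      obtain ⟨p, rfl⟩ := hg m
      rw [hj] at hm
      rw [← hm]
      exact Subtype.ext (QuotSMulTop.mk_eq_zero_iff.2 ⟨p, rfl⟩)
  have hΩ (i : ℕ) := succ_iff (N := N) (LinearMap.ker g').subtype_injective
    (LinearMap.exact_subtype_ker_map g') hg'surj i
  have hU (i : ℕ) := (quotSMulTop_iff hx (N := N) hL i).trans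
    (succ_iff (N := N) L.subtype_injective (LinearMap.exact_subtype_ker_map g) hg i).symm
  refine ⟨fun hA hB ↦ ?_, fun hB hB' ↦ ?_⟩
  · exact sub_left hjinj hjq hq ((hU i).2 hA) ((hΩ (i + 1)).1 hB)
  · exact (hU i).1 (middle_left hjinj hjq hq hB ((hΩ i).1 hB'))

theorem pi_quotient (hx : IsSMulRegular A x) (n i : ℕ) (N : Type u) [AddCommGroup N]
    [Module A N] : ExtVanishes A (Fin n → A ⧸ Ideal.span {x}) N (i + 2) := by
  refine quotient_left (f := LinearMap.lsmul A (Fin n → A) x)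
    (g := (Ideal.span {x}).mkQ.compLeft (Fin n)) hx.pi_const ?_ ?_
    (of_projective A N _ i) (of_projective A N _ (i + 1))
  · intro v
    constructor
    · intro h
      have hv (k : Fin n) : ∃ a, a * x = v k := Ideal.mem_span_singleton'.1
        ((Submodule.Quotient.mk_eq_zero _).1 (congrFun h k))
      choose w hw using hv
      exact ⟨w, funext fun k ↦ (mul_comm _ _).trans (hw k)⟩
    · rintro ⟨w, rfl⟩
      exact funext fun k ↦ (Submodule.Quotient.mk_eq_zero _).2
        (Ideal.mul_mem_right _ _ (Ideal.mem_span_singleton_self x))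
  · intro v
    choose w hw using fun k ↦ (Ideal.span {x}).mkQ_surjective (v k)
    exact ⟨w, funext hw⟩

/-- The degree one case of Rees' isomorphism `Ext_B^i(M, B) = Ext_A^{i+1}(M, A)`, `B = A ⧸ (x)`:
maps from a `B`-module `K` to `B` correspond to classes in `Ext_A^1(K, A)` by composition with the
class of `0 → A → A → B → 0`. -/
theorem quotient_one_of_two (hx : IsSMulRegular A x) {K F M : Type u}
    [AddCommGroup K] [Module A K] [Module (A ⧸ Ideal.span {x}) K]
    [IsScalarTower A (A ⧸ Ideal.span {x}) K]
    [AddCommGroup F] [Module A F] [Module (A ⧸ Ideal.span {x}) F]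
    [IsScalarTower A (A ⧸ Ideal.span {x}) F]
    [AddCommGroup M] [Module A M] [Module (A ⧸ Ideal.span {x}) M]
    [IsScalarTower A (A ⧸ Ideal.span {x}) M]
    [Module.Projective (A ⧸ Ideal.span {x}) F]
    {f : K →ₗ[A ⧸ Ideal.span {x}] F} {g : F →ₗ[A ⧸ Ideal.span {x}] M}
    (hf : Function.Injective f) (h : Function.Exact f g) (hg : Function.Surjective g)
    (hM : ExtVanishes A M A 2) : ExtVanishes (A ⧸ Ideal.span {x}) M (A ⧸ Ideal.span {x}) 1 := by
  refine one_of_extends hf h hg (of_projective _ _ F 0) fun φ ↦ ?_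
  have hex : Function.Exact (LinearMap.lsmul A A x) (Ideal.span {x}).mkQ := by
    intro a
    rw [Submodule.mkQ_apply, Submodule.Quotient.mk_eq_zero, Ideal.mem_span_singleton']
    simp [mul_comm]
  have hS := hex.moduleCatShortExact hx (Ideal.span {x}).mkQ_surjective
  have hT := Function.Exact.moduleCatShortExact (f := f.restrictScalars A)
    (g := g.restrictScalars A) h hf hg
  let φA : ModuleCat.of A K ⟶ ModuleCat.of A (A ⧸ Ideal.span {x}) :=
    ModuleCat.ofHom (φ.restrictScalars A)
  obtain ⟨e, he⟩ := Ext.contravariant_sequence_exact₁ hT _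
    ((Ext.mk₀ φA).comp hS.extClass (zero_add 1)) (add_comm 1 1) (extVanishes_iff.1 hM _)
  -- `x` acts on the class `e` of `Ext¹(F, A)` through `F`, where it is zero, and through `A`
  have hxe : e.comp (Ext.mk₀ (x • 𝟙 (ModuleCat.of A A))) (add_zero 1) = 0 := by
    have h0 : x • 𝟙 (ModuleCat.of A F) = 0 := by
      ext y
      exact QuotSMulTop.smul_eq_zero_of_quotient y
    have h1 : (Ext.mk₀ (x • 𝟙 (ModuleCat.of A F))).comp e (zero_add 1) = 0 := by
      rw [h0, Ext.mk₀_zero, Ext.zero_comp]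
    rw [Ext.mk₀_smul, Ext.smul_comp, Ext.mk₀_id_comp] at h1
    rw [Ext.mk₀_smul, Ext.comp_smul, Ext.comp_mk₀_id, h1]
  obtain ⟨γ', hγ'⟩ := Ext.covariant_sequence_exact₁ _ hS e hxe (zero_add 1)
  obtain ⟨γ, rfl⟩ := (Ext.mk₀_bijective _ _).2 γ'
  have hzero : (Ext.mk₀ (ModuleCat.ofHom (f.restrictScalars A) ≫ γ - φA)).comp hS.extClass
      (zero_add 1) = 0 := by
    rw [sub_eq_add_neg, Ext.mk₀_add, Ext.mk₀_neg, Ext.add_comp, Ext.neg_comp,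
      ← Ext.mk₀_comp_mk₀, ← he, ← hγ', Ext.comp_assoc_of_second_deg_zero]
    exact add_neg_cancel _
  obtain ⟨θ', hθ'⟩ := Ext.covariant_sequence_exact₃ _ hS _ _ hzero
  obtain ⟨θ, rfl⟩ := (Ext.mk₀_bijective _ _).2 θ'
  -- there are no maps `K → A`, since `x` is zero on `K` and regular on `A`
  have hθ : θ = 0 := by
    ext k
    refine hx.right_eq_zero_of_smul ?_
    change x • θ.hom k = 0
    rw [← map_smul, QuotSMulTop.smul_eq_zero_of_quotient, map_zero]
  rw [hθ, Ext.mk₀_zero, Ext.zero_comp, eq_comm, Ext.mk₀_eq_zero_iff, sub_eq_zero] at hθ'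
  refine ⟨γ.hom.extendScalarsOfSurjective Ideal.Quotient.mk_surjective, LinearMap.ext fun k ↦ ?_⟩
  exact LinearMap.congr_fun (congrArg ModuleCat.Hom.hom hθ') k

/-- The vanishing consequence of Rees' isomorphism in all positive degrees, by dimension shifting
in `M`: finite free `A ⧸ (x)`-modules have projective dimension at most one over `A`. -/
theorem quotient_of_succ [IsNoetherianRing A] (hx : IsSMulRegular A x) {M : Type u}
    [AddCommGroup M] [Module A M] [Module (A ⧸ Ideal.span {x}) M]
    [IsScalarTower A (A ⧸ Ideal.span {x}) M] [Module.Finite (A ⧸ Ideal.span {x}) M] (i : ℕ)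
    (hM : ExtVanishes A M A (i + 2)) :
    ExtVanishes (A ⧸ Ideal.span {x}) M (A ⧸ Ideal.span {x}) (i + 1) := by
  induction i generalizing M with
  | zero =>
    obtain ⟨r, g, hg, -⟩ := Module.Finite.exists_presentation (R := A ⧸ Ideal.span {x}) M
    exact quotient_one_of_two hx (LinearMap.ker g).subtype_injective
      (LinearMap.exact_subtype_ker_map g) hg hM
  | succ i ih =>
    obtain ⟨r, g, hg, _⟩ := Module.Finite.exists_presentation (R := A ⧸ Ideal.span {x}) M
    rw [succ_iff (LinearMap.ker g).subtype_injective (LinearMap.exact_subtype_ker_map g) hg i]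
    refine ih (M := LinearMap.ker g) ?_
    exact sub_left (f := (LinearMap.ker g).subtype.restrictScalars A) (g := g.restrictScalars A)
      (LinearMap.ker g).subtype_injective (LinearMap.exact_subtype_ker_map g) hg
      (pi_quotient hx r i A) hM

end ExtVanishes

/-- A uniform bound `n` on the degrees in which `Ext` lives, whenever these are finite in number,
and on the self-injective dimension. Unlike finite global dimension, this passes from a regular
local ring to a complete intersection. -/
structure HasExtBound (A : Type u) [CommRing A] (n : ℕ) : Prop where
  /-- If `Ext^i(M, N)` vanishes for large `i`, with `M` finite, it vanishes for all `i > n`. -/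
  of_eventually (M N : Type u) [AddCommGroup M] [Module A M] [Module.Finite A M] [AddCommGroup N]
    [Module A N] : (∃ k, ∀ i ≥ k, ExtVanishes A M N i) → ∀ i > n, ExtVanishes A M N i
  /-- The ring has self-injective dimension at most `n`. -/
  self (M : Type u) [AddCommGroup M] [Module A M] [Module.Finite A M] :
    ∀ i > n, ExtVanishes A M A i

theorem HasExtBound.quotient [IsNoetherianRing A] {n : ℕ} (h : HasExtBound A n)
    (hx : IsSMulRegular A x) : HasExtBound (A ⧸ Ideal.span {x}) n where
  of_eventually M N _ _ _ _ _ := by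
    let := Module.compHom M (algebraMap A (A ⧸ Ideal.span {x}))
    let := Module.compHom N (algebraMap A (A ⧸ Ideal.span {x}))
    have : IsScalarTower A (A ⧸ Ideal.span {x}) M := IsScalarTower.of_algebraMap_smul fun _ _ ↦ rfl
    have : IsScalarTower A (A ⧸ Ideal.span {x}) N := IsScalarTower.of_algebraMap_smul fun _ _ ↦ rfl
    have : Module.Finite A M := Module.Finite.trans (A ⧸ Ideal.span {x}) M
    rintro ⟨k, hk⟩
    have hA : ∀ i > n, ExtVanishes A M N i := h.of_eventually M N ⟨k + 2, fun i hi ↦ by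
      obtain ⟨i, rfl⟩ : ∃ j, i = j + 2 := ⟨i - 2, by omega⟩
      exact (ExtVanishes.quotient_periodicity hx i).2 (hk _ (by omega)) (hk _ (by omega))⟩
    -- above degree `n`, vanishing in degree `i + 2` implies vanishing in degree `i`
    have descend (s : ℕ) : ∀ i > n, i + 2 * s ≥ k → ExtVanishes (A ⧸ Ideal.span {x}) M N i := by
      induction s with
      | zero => exact fun i _ hi ↦ hk i hi
      | succ s ih =>
        intro i hi hik
        obtain ⟨i, rfl⟩ : ∃ j, i = j + 1 := ⟨i - 1, by omega⟩
        exact (ExtVanishes.quotient_periodicity hx i).1 (hA _ (by omega))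
          (ih (i + 3) (by omega) (by omega))
    exact fun i hi ↦ descend k i hi (by omega)
  self M _ _ _ := by
    let := Module.compHom M (algebraMap A (A ⧸ Ideal.span {x}))
    have : IsScalarTower A (A ⧸ Ideal.span {x}) M := IsScalarTower.of_algebraMap_smul fun _ _ ↦ rfl
    have : Module.Finite A M := Module.Finite.trans (A ⧸ Ideal.span {x}) M
    intro i hi
    obtain ⟨i, rfl⟩ : ∃ j, i = j + 1 := ⟨i - 1, by omega⟩
    exact ExtVanishes.quotient_of_succ hx i (h.self M _ (by omega))

end ChangeOfRings

/-! ### Faithfully flat descent of `Ext` bounds -/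

section Descent

open TensorProduct

variable {R : Type u} [CommRing R] [IsNoetherianRing R] {S : Type u} [CommRing S] [Algebra R S]

/-- A map of `Hom` modules induced by `f : K → F` is surjective after base change along a
faithfully flat `R → S` if and only if it is surjective. -/
theorem lcomp_baseChange_surjective_iff [Module.FaithfullyFlat R S] {K F N : Type u}
    [AddCommGroup K] [Module R K] [Module.Finite R K] [AddCommGroup F] [Module R F]
    [Module.Finite R F] [AddCommGroup N] [Module R N] (f : K →ₗ[R] F) :
    Function.Surjective ((f.baseChange S).lcomp S (S ⊗[R] N)) ↔
      Function.Surjective (f.lcomp R N) := by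
  have hK := Module.finitePresentation_of_finite R K
  have hF := Module.finitePresentation_of_finite R F
  let eK := (Module.FinitePresentation.isBaseChange_map R K N S).equiv
  let eF := (Module.FinitePresentation.isBaseChange_map R F N S).equiv
  have hsq : ((f.baseChange S).lcomp S (S ⊗[R] N)) ∘ₗ eF.toLinearMap =
      eK.toLinearMap ∘ₗ (f.lcomp R N).baseChange S := by
    refine TensorProduct.AlgebraTensorModule.curry_injective (LinearMap.ext fun s ↦
      LinearMap.ext fun φ ↦ TensorProduct.AlgebraTensorModule.curry_injective
        (LinearMap.ext fun t ↦ LinearMap.ext fun k ↦ ?_))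
    simp [eK, eF, IsBaseChange.equiv_tmul]
  have h1 : Function.Surjective ((f.baseChange S).lcomp S (S ⊗[R] N)) ↔
      Function.Surjective ((f.lcomp R N).lTensor S) := by
    have hsq' : ((f.baseChange S).lcomp S (S ⊗[R] N)) ∘ eF = eK ∘ (f.lcomp R N).lTensor S :=
      funext fun t ↦ LinearMap.congr_fun hsq t
    rw [← EquivLike.surjective_comp eF, hsq', EquivLike.comp_surjective]
  rw [h1]
  exact Module.FaithfullyFlat.lTensor_surjective_iff_surjective R S _

theorem ExtVanishes.baseChange_iff [Module.FaithfullyFlat R S] {M N : Type u} [AddCommGroup M]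
    [Module R M] [Module.Finite R M] [AddCommGroup N] [Module R N] (i : ℕ) :
    ExtVanishes S (S ⊗[R] M) (S ⊗[R] N) (i + 1) ↔ ExtVanishes R M N (i + 1) := by
  induction i generalizing M with
  | zero =>
    obtain ⟨r, g, hg, _⟩ := Module.Finite.exists_presentation (R := R) M
    have hi := (LinearMap.ker g).subtype_injective
    have hex := LinearMap.exact_subtype_ker_map g
    rw [zero_add, one_iff hi hex hg, one_iff (f := (LinearMap.ker g).subtype.baseChange S)
      (g := g.baseChange S) (Module.Flat.lTensor_preserves_injective_linearMap _ hi)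
      (lTensor_exact S hex hg) (LinearMap.lTensor_surjective S hg)]
    exact lcomp_baseChange_surjective_iff _
  | succ i ih =>
    obtain ⟨r, g, hg, _⟩ := Module.Finite.exists_presentation (R := R) M
    have hi := (LinearMap.ker g).subtype_injective
    have hex := LinearMap.exact_subtype_ker_map g
    rw [succ_iff hi hex hg, succ_iff (f := (LinearMap.ker g).subtype.baseChange S)
      (g := g.baseChange S) (Module.Flat.lTensor_preserves_injective_linearMap _ hi)
      (lTensor_exact S hex hg) (LinearMap.lTensor_surjective S hg)]
    exact ih

variable (R S) in
theorem HasExtBound.of_faithfullyFlat [Module.FaithfullyFlat R S] {n : ℕ} (h : HasExtBound S n) :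
    HasExtBound R n where
  of_eventually M N _ _ _ _ _ := by
    rintro ⟨k, hk⟩ i hi
    obtain ⟨i, rfl⟩ : ∃ j, i = j + 1 := ⟨i - 1, by omega⟩
    refine (ExtVanishes.baseChange_iff (S := S) i).1
      (h.of_eventually _ _ ⟨k + 1, fun j hj ↦ ?_⟩ _ hi)
    obtain ⟨j, rfl⟩ : ∃ l, j = l + 1 := ⟨j - 1, by omega⟩
    exact (ExtVanishes.baseChange_iff j).2 (hk _ (by omega))
  self M _ _ _ i hi := by
    obtain ⟨i, rfl⟩ : ∃ j, i = j + 1 := ⟨i - 1, by omega⟩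
    refine (ExtVanishes.baseChange_iff (S := S) i).1 ?_
    exact (h.self (S ⊗[R] M) _ hi).congr_right (TensorProduct.AlgebraTensorModule.rid R S S).symm

theorem HasExtBound.of_ringEquiv {A B : Type u} [CommRing A] [CommRing B] [IsNoetherianRing B]
    (e : A ≃+* B) {n : ℕ} (h : HasExtBound A n) : HasExtBound B n := by
  let := e.symm.toRingHom.toAlgebra
  have : Module.FaithfullyFlat B A := Module.FaithfullyFlat.of_linearEquiv B B
    { e.symm.toAddEquiv.symm with
      map_smul' := fun b a ↦ by
        change e (e.symm b * a) = b * e a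
        simp }
  exact h.of_faithfullyFlat B A

end Descent

/-! ### Complete intersections, and the theorem -/

section CompleteIntersection

open RingTheory.Sequence

theorem HasExtBound.quotient_ofList {S : Type u} [CommRing S] [IsNoetherianRing S] {n : ℕ}
    (h : HasExtBound S n) {rs : List S} (hrs : IsWeaklyRegular S rs) :
    HasExtBound (S ⧸ Ideal.ofList rs) n := by
  obtain ⟨l, hl⟩ : ∃ l, rs.length = l := ⟨_, rfl⟩
  induction l generalizing S with
  | zero =>
    rw [List.length_eq_zero_iff.1 hl, Ideal.ofList_nil]
    exact h.of_ringEquiv (RingEquiv.quotientBot S).symm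
  | succ l ih =>
    match rs, hl with
    | x :: rs, hl =>
      obtain ⟨hx, hrs⟩ := (isWeaklyRegular_cons_iff S x rs).1 hrs
      have e : (S ⧸ Ideal.span {x}) ≃ₗ[S] QuotSMulTop x S := Submodule.quotEquivOfEq _ _ <| by
        rw [← Submodule.ideal_span_singleton_smul, smul_eq_mul, Ideal.mul_top]
      have hrs' : IsWeaklyRegular (S ⧸ Ideal.span {x})
          (rs.map (Ideal.Quotient.mk (Ideal.span {x}))) :=
        (isWeaklyRegular_map_algebraMap_iff (S ⧸ Ideal.span {x}) _ rs).2
          ((e.isWeaklyRegular_congr rs).2 hrs)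
      have key := ih (h.quotient hx) hrs' (by simpa using hl)
      rw [← Ideal.map_ofList] at key
      rw [Ideal.ofList_cons]
      exact key.of_ringEquiv (DoubleQuot.quotQuotEquivQuotSup _ _)

theorem IsCompleteIntersectionLocalRing.exists_hasExtBound (R : Type u) [CommRing R]
    [IsCompleteIntersectionLocalRing R] : ∃ n, HasExtBound R n := by
  obtain ⟨S, _, _, rs, hrs, ⟨e⟩⟩ :=
    IsCompleteIntersectionLocalRing.exists_presentation (R := R)
  obtain ⟨n, hn⟩ := IsRegularLocalRing.exists_extVanishes S
  have hS : HasExtBound S n := ⟨fun M N _ _ _ _ _ _ ↦ hn M N, fun M _ _ _ ↦ hn M S⟩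
  have : IsNoetherianRing (AdicCompletion (maximalIdeal R) R) := isNoetherianRing_of_ringEquiv _ e
  have hfg := (maximalIdeal R).fg_of_isNoetherianRing
  have := AdicCompletion.isLocalRing_of_fg hfg
  have := AdicCompletion.algebraMap_isLocalHom_of_fg hfg
  have : Module.FaithfullyFlat R (AdicCompletion (maximalIdeal R) R) :=
    Module.FaithfullyFlat.of_flat_of_isLocalHom
  exact ⟨n, ((hS.quotient_ofList hrs.toIsWeaklyRegular).of_ringEquiv e).of_faithfullyFlat R _⟩

end CompleteIntersection

theorem extSup_le_iff {R : Type u} [CommRing R] {M N : ModuleCat.{u} R} {n : ℕ} :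
    extSup M N ≤ n ↔ ∀ i > n, Subsingleton (Ext M N i) := by
  simp only [extSup, iSup_le_iff, Nat.cast_le]
  refine forall_congr' fun i ↦ ?_
  rw [← not_nontrivial_iff_subsingleton, ← not_imp_not, not_le]

theorem exists_extVanishes_of_xi_lt_top {R : Type u} [CommRing R] (h : xi R < ⊤) :
    ∃ n : ℕ, ∀ (M N : Type u) [AddCommGroup M] [Module R M] [Module.Finite R M] [AddCommGroup N]
      [Module R N], (∃ k, ∀ i ≥ k, ExtVanishes R M N i) → ∀ i > n, ExtVanishes R M N i := by
  obtain ⟨n, hn⟩ := ENat.ne_top_iff_exists.1 h.ne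
  refine ⟨n, fun M N _ _ _ _ _ ⟨k, hk⟩ ↦ ?_⟩
  have hle : extSup (ModuleCat.of R M) (ModuleCat.of R N) ≤ (k : ℕ∞) :=
    extSup_le_iff.2 fun i hi ↦ hk i hi.le
  refine extSup_le_iff.1 (hn ▸ ?_)
  exact le_iSup₂_of_le (ModuleCat.of R M) (ModuleCat.of R N)
    (le_iSup₂_of_le ‹_› (hle.trans_lt (ENat.natCast_lt_top k)) le_rfl)

theorem theorem2p4 {R : Type u} [CommRing R] (d : ℕ) (hd : ringKrullDim R = d) :
    (IsGorensteinLocalRing R → xi R < ⊤ →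
      ∀ (M N : ModuleCat.{u} R), Module.Finite R M →
        (∃ n : ℕ, ∀ i ≥ n, Subsingleton (Ext M N i)) →
        ∀ i > d, Subsingleton (Ext N M i)) ∧
    (IsCompleteIntersectionLocalRing R →
      ∀ (M N : ModuleCat.{u} R), Module.Finite R M →
        (∃ n : ℕ, ∀ i ≥ n, Subsingleton (Ext M N i)) →
        ∀ i > d, Subsingleton (Ext N M i)) := by
  have core {n m : ℕ} [IsLocalRing R] [IsNoetherianRing R]
      (hself : ∀ i > m, ExtVanishes R (R ⧸ maximalIdeal R) R i)
      (hbound : ∀ (M N : Type u) [AddCommGroup M] [Module R M] [Module.Finite R M]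
        [AddCommGroup N] [Module R N],
        (∃ k, ∀ i ≥ k, ExtVanishes R M N i) → ∀ i > n, ExtVanishes R M N i)
      (M N : ModuleCat.{u} R) (hM : Module.Finite R M)
      (hMN : ∃ n : ℕ, ∀ i ≥ n, Subsingleton (Ext M N i)) : ∀ i > d, Subsingleton (Ext N M i) :=
    ExtVanishes.symm_of_bounded (ExtVanishes.of_gt_ringKrullDim hd hself)
      (fun M ↦ hbound M N) M hMN
  constructor
  · intro _ hxi
    obtain ⟨m, hm⟩ := (injectiveDimension_ne_top_iff _).1
      (IsGorensteinLocalRing.injectiveDimension_ne_top (R := R))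
    obtain ⟨n, hn⟩ := exists_extVanishes_of_xi_lt_top hxi
    exact core (fun i hi ↦ HasInjectiveDimensionLT.subsingleton _ (m + 1) i hi _) hn
  · intro _
    obtain ⟨n, hn⟩ := IsCompleteIntersectionLocalRing.exists_hasExtBound R
    exact core (hn.self _) hn.of_eventually
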